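/- For $N\ge 1$ let $\rho_{(1),N}^{\rm GUE}$ be the eigenvalue density (one-point correlation function, of total mass $N$) of the Gaussian unitary ensemble, i.e. of the $N$ real eigenvalues with joint probability density proportional to $$\prod_{l=1}^N e^{-x_l^2}\prod_{1\le j<k\le N}|x_k-x_j|^2 ,$$ and let $$\rho_{(1),N}^{\rm GUE,s}(y)=\frac{1}{\sqrt2\,N^{1/6}}\,\rho_{(1),N}^{\rm GUE}\Big(\sqrt{2N}+\frac{y}{\sqrt2\,N^{1/6}}\Big)$$ be the density in soft edge scaling. There are functions $r_0^{\rm G},r_1^{\rm G},r_2^{\rm G}:\mathbb R\to\mathbb R$ (necessarily unique) such that, for every fixed $y\in\mathbb R$, as $N\to\infty$, $$\rho_{(1),N}^{\rm GUE,s}(y)=r_0^{\rm G}(y)+4^{-1}N^{-2/3}\,r_1^{\rm G}(y)+4^{-2}N^{-4/3}\,r_2^{\rm G}(y)+o(N^{-4/3}).$$ For every $\gamma\in\mathbb C$ with ${\rm Re}(\gamma)>0$, the bilateral Laplace transforms $$u_j(\gamma)=\int_{-\infty}^\infty e^{\gamma y}\,r_j^{\rm G}(y)\,dy,\qquad j=0,1,2,$$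 converge absolutely, and, with principal branches of the powers of $\gamma$, $$u_0(\gamma)=\frac{e^{\gamma^3/12}}{2\sqrt\pi\,\gamma^{3/2}},\qquad u_1(\gamma)=-\frac{e^{\gamma^3/12}}{160\sqrt\pi\,\gamma^{5/2}}\big(60+20\gamma^3+\gamma^6\big),$$ $$u_2(\gamma)=\frac{e^{\gamma^3/12}}{179200\sqrt\pi\,\gamma^{7/2}}\big(-42000+28000\gamma^3+14840\gamma^6+680\gamma^9+7\gamma^{12}\big).$$ -/

import Mathlib

open MeasureTheory Filter Asymptotics

noncomputable section

/-- The unnormalised eigenvalue probability density of the Gaussian unitary ensemble (Dyson index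
`β = 2`): `∏ₗ exp (-xₗ²) * ∏_{j<k} |xₖ - xⱼ|²`. -/
def gueWeight {N : ℕ} (x : Fin N → ℝ) : ℝ :=
  (∏ l, Real.exp (-(x l) ^ 2)) * ∏ j, ∏ k ∈ Finset.Ioi j, |x k - x j| ^ 2

/-- The normalisation constant of the GUE eigenvalue probability density. -/
def gueNormalization (N : ℕ) : ℝ := ∫ x : Fin N → ℝ, gueWeight x

/-- The GUE eigenvalue density (one-point correlation function): `N` times the marginal density of
one eigenvalue, obtained by integrating out the other `N - 1` variables. Its total mass is `N`. -/
def gueDensity : ℕ → ℝ → ℝ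
  | 0, _ => 0
  | n + 1, x => ((n + 1 : ℕ) : ℝ) *
      ((∫ v : Fin n → ℝ, gueWeight (Fin.cons x v : Fin (n + 1) → ℝ)) / gueNormalization (n + 1))

/-- The GUE eigenvalue density in soft edge scaling variables. -/
def gueSoftEdgeDensity (N : ℕ) (y : ℝ) : ℝ :=
  1 / (√2 * (N : ℝ) ^ (1 / 6 : ℝ)) *
    gueDensity N (√(2 * N) + y / (√2 * (N : ℝ) ^ (1 / 6 : ℝ)))

/-- `r 0, …, r m` are the coefficients in the large `N` expansion, at each fixed `y`, of the soft
edge scaled GUE density in powers of `N ^ (-2/3)` up to order `m`: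
`ρ_N(y) = ∑_{i ≤ m} 4⁻ⁱ N^(-2i/3) rᵢ(y) + o(N^(-2m/3))`. -/
def IsGUESoftEdgeExpansion (m : ℕ) (r : ℕ → ℝ → ℝ) : Prop :=
  ∀ y : ℝ,
    (fun N : ℕ => gueSoftEdgeDensity N y -
      ∑ i ∈ Finset.range (m + 1), ((4 : ℝ) ^ i)⁻¹ * (N : ℝ) ^ (-(2 * i / 3 : ℝ)) * r i y)
    =o[atTop] fun N : ℕ => (N : ℝ) ^ (-(2 * m / 3 : ℝ))

/-- The bilateral Laplace transform `∫ exp (γ y) f(y) dy` over the real line. -/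
def bilateralLaplace (f : ℝ → ℝ) (γ : ℂ) : ℂ :=
  ∫ y : ℝ, Complex.exp (γ * y) * (f y : ℂ)

end

/-! ### Monic Hermite polynomials for the weight `exp (-x²)` -/

open Polynomial in
/-- The monic orthogonal polynomials for the weight `exp (-x²)` on the real line. -/
noncomputable def monicHermite : ℕ → ℝ[X]
  | 0 => 1
  | n + 1 => X * monicHermite n - C (1 / 2) * derivative (monicHermite n)

namespace monicHermite

open Polynomial

lemma derivative_succ (n : ℕ) :
    derivative (monicHermite (n + 1)) = C ((n : ℝ) + 1) * monicHermite n := by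
  induction n with
  | zero => simp [monicHermite]
  | succ n ih =>
    rw [monicHermite, derivative_sub, derivative_C_mul, derivative_mul, ih, derivative_X,
      derivative_C_mul]
    have h : monicHermite (n + 1)
        = X * monicHermite n - C (1 / 2) * derivative (monicHermite n) := rfl
    push_cast
    simp only [map_add, map_one]
    linear_combination -(C (n : ℝ) + 1) * h

lemma eval_succ_succ (n : ℕ) (x : ℝ) :
    (monicHermite (n + 2)).eval x
      = x * (monicHermite (n + 1)).eval x - ((n : ℝ) + 1) / 2 * (monicHermite n).eval x := by
  rw [monicHermite, derivative_succ]
  simp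
  ring

lemma monic_and_natDegree (n : ℕ) : (monicHermite n).Monic ∧ (monicHermite n).natDegree = n := by
  induction n with
  | zero => exact ⟨monic_one, natDegree_one⟩
  | succ n ih =>
    have hm : (X * monicHermite n).Monic := monic_X.mul ih.1
    have hd : (X * monicHermite n).degree = ((n + 1 : ℕ) : WithBot ℕ) := by
      rw [degree_eq_natDegree hm.ne_zero, monic_X.natDegree_mul ih.1, ih.2, natDegree_X, add_comm]
    have hlt : (C (1 / 2 : ℝ) * derivative (monicHermite n)).degree
        < (X * monicHermite n).degree := by
      rw [hd]
      rw [degree_C_mul (by norm_num)]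
      refine degree_derivative_le.trans_lt ?_
      rw [degree_eq_natDegree ih.1.ne_zero, ih.2]
      exact_mod_cast Nat.lt_succ_self n
    refine ⟨hm.sub_of_left hlt, ?_⟩
    rw [monicHermite]
    exact natDegree_eq_of_degree_eq_some ((degree_sub_eq_left_of_degree_lt hlt).trans hd)

end monicHermite

lemma integrable_polynomial_mul_exp_neg_sq (p : Polynomial ℝ) :
    Integrable fun x : ℝ => p.eval x * Real.exp (-x ^ 2) := by
  induction p using Polynomial.induction_on' with
  | add p q hp hq => simpa only [Polynomial.eval_add, add_mul] using! hp.add hq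
  | monomial n a =>
    have h := (integrable_rpow_mul_exp_neg_mul_sq one_pos (s := n)
      (lt_of_lt_of_le (by norm_num) n.cast_nonneg)).const_mul a
    simpa [mul_assoc] using h

namespace monicHermite

open Polynomial

lemma integrable_mul (m n : ℕ) : Integrable fun x : ℝ =>
    (monicHermite m).eval x * (monicHermite n).eval x * Real.exp (-x ^ 2) := by
  simpa using integrable_polynomial_mul_exp_neg_sq (monicHermite m * monicHermite n)

/-- Integration by parts: p_{n+1} exp(-x²) is -1/2 times the derivative of p_n exp(-x²). -/
lemma integral_succ_mul (n : ℕ) (q : ℝ[X]) :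
    ∫ x : ℝ, (monicHermite (n + 1)).eval x * q.eval x * Real.exp (-x ^ 2)
      = 1 / 2 * ∫ x : ℝ, (monicHermite n).eval x * (derivative q).eval x * Real.exp (-x ^ 2) := by
  have hderiv : ∀ x : ℝ, HasDerivAt
      (fun x => (monicHermite n * q).eval x * Real.exp (-x ^ 2))
      ((monicHermite n * derivative q).eval x * Real.exp (-x ^ 2)
        - 2 * ((monicHermite (n + 1) * q).eval x * Real.exp (-x ^ 2))) x := by
    intro x
    have h1 := (monicHermite n * q).hasDerivAt x
    have h2 : HasDerivAt (fun x : ℝ => Real.exp (-x ^ 2)) (Real.exp (-x ^ 2) * (-(2 * x))) x := by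
      simpa using ((hasDerivAt_pow 2 x).neg).exp
    convert! h1.mul h2 using 1
    simp [monicHermite]
    ring
  have hi := integrable_polynomial_mul_exp_neg_sq
  have h := integral_eq_zero_of_hasDerivAt_of_integrable hderiv
    ((hi _).sub ((hi _).const_mul 2)) (hi _)
  rw [integral_sub (hi _) ((hi _).const_mul 2), integral_const_mul] at h
  simp only [eval_mul] at h
  linarith

/-- The squared norm of `monicHermite n` for the weight `exp (-x²)`. -/
noncomputable def normSq (n : ℕ) : ℝ := √Real.pi * n.factorial / 2 ^ n

lemma normSq_pos (n : ℕ) : 0 < normSq n := by unfold normSq; positivity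

/-- Each integration by parts lowers both indices by one and produces the factor (n+1)/2; unequal
indices end in the derivative of a constant. -/
lemma integral_mul (m n : ℕ) :
    ∫ x : ℝ, (monicHermite m).eval x * (monicHermite n).eval x * Real.exp (-x ^ 2)
      = if m = n then normSq n else 0 := by
  induction m generalizing n with
  | zero =>
    cases n with
    | zero => simpa [monicHermite, normSq] using integral_gaussian 1
    | succ n =>
      have h := integral_succ_mul n (monicHermite 0)
      simp only [mul_comm ((monicHermite (n + 1)).eval _)] at h
      rw [h]
      simp [monicHermite]
  | succ m ih =>
    rw [integral_succ_mul]
    cases n with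
    | zero => simp [monicHermite]
    | succ n =>
      have e : ∀ x : ℝ, (monicHermite m).eval x * (derivative (monicHermite (n + 1))).eval x
          * Real.exp (-x ^ 2) = ((n : ℝ) + 1) *
            ((monicHermite m).eval x * (monicHermite n).eval x * Real.exp (-x ^ 2)) := by
        intro x
        rw [derivative_succ]
        simp
        ring
      simp only [e]
      rw [integral_const_mul, ih]
      by_cases h : m = n
      · subst h
        simp only [if_true, normSq, Nat.factorial_succ, pow_succ]
        push_cast
        ring
      · simp [h]

end monicHermite

/-! ### The one-point function as a sum of squares -/

/-- The entries `p_j p_k exp (-x²)` of the (symmetrised) Hermite kernel. -/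
noncomputable def hermiteProduct (j k : ℕ) (x : ℝ) : ℝ :=
  (monicHermite j).eval x * (monicHermite k).eval x * Real.exp (-x ^ 2)

lemma gueWeight_eq_sum_perm {N : ℕ} (x : Fin N → ℝ) :
    gueWeight x = ∑ σ : Equiv.Perm (Fin N), ∑ τ : Equiv.Perm (Fin N),
      (((Equiv.Perm.sign σ : ℤ) : ℝ) * ((Equiv.Perm.sign τ : ℤ) : ℝ)) *
        ∏ i, hermiteProduct (σ i) (τ i) (x i) := by
  -- The Vandermonde determinant does not change when the monomials are replaced by monic
  -- polynomials of the same degrees.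
  have hdet : ∏ j, ∏ k ∈ Finset.Ioi j, |x k - x j| ^ 2
      = (Matrix.of fun i j : Fin N => (monicHermite (j : ℕ)).eval (x i)).det ^ 2 := by
    rw [← Matrix.det_eval_matrixOfPolynomials_eq_det_vandermonde x
      (fun j => monicHermite (j : ℕ)) (fun j => (monicHermite.monic_and_natDegree j).2)
      (fun j => (monicHermite.monic_and_natDegree j).1), Matrix.det_vandermonde]
    simp [sq_abs, Finset.prod_pow]
  rw [gueWeight, hdet, ← Matrix.det_transpose, Matrix.det_apply', sq, Finset.sum_mul_sum,
    Finset.mul_sum]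
  refine Finset.sum_congr rfl fun σ _ => ?_
  rw [Finset.mul_sum]
  refine Finset.sum_congr rfl fun τ _ => ?_
  simp only [Matrix.transpose_apply, Matrix.of_apply, hermiteProduct, Finset.prod_mul_distrib]
  ring

lemma integrable_prod_hermiteProduct {n : ℕ} (f g : Fin n → ℕ) :
    Integrable fun x : Fin n → ℝ => ∏ i, hermiteProduct (f i) (g i) (x i) :=
  Integrable.fintype_prod (f := fun i => hermiteProduct (f i) (g i))
    fun _ => monicHermite.integrable_mul _ _

lemma integral_prod_hermiteProduct {n : ℕ} (f g : Fin n → ℕ) :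
    ∫ x : Fin n → ℝ, ∏ i, hermiteProduct (f i) (g i) (x i)
      = if f = g then ∏ i, monicHermite.normSq (g i) else 0 := by
  rw [integral_fintype_prod_volume_eq_prod fun i => hermiteProduct (f i) (g i)]
  simp only [hermiteProduct, monicHermite.integral_mul]
  split_ifs with h
  · simp [h]
  · obtain ⟨i, hi⟩ := Function.ne_iff.mp h
    exact Finset.prod_eq_zero (Finset.mem_univ i) (by simp [hi])

lemma sign_mul_self_cast {α : Type*} [DecidableEq α] [Fintype α] (σ : Equiv.Perm α) :
    ((Equiv.Perm.sign σ : ℤ) : ℝ) * ((Equiv.Perm.sign σ : ℤ) : ℝ) = 1 := by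
  rw [← Int.cast_mul, ← Units.val_mul, Int.units_mul_self]
  simp

/-- Orthogonality kills every pair σ ≠ τ in the double Leibniz expansion; each of the N! diagonal
pairs contributes the full product of norms. -/
lemma gueNormalization_eq (N : ℕ) :
    gueNormalization N = N.factorial * ∏ i : Fin N, monicHermite.normSq i := by
  have hperm : ∀ σ τ : Equiv.Perm (Fin N),
      ((fun i => ((σ i : Fin N) : ℕ)) = fun i => ((τ i : Fin N) : ℕ)) ↔ σ = τ := by
    intro σ τ
    refine ⟨fun h => Equiv.ext fun i => Fin.ext (congrFun h i), fun h => by rw [h]⟩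
  simp only [gueNormalization, gueWeight_eq_sum_perm]
  rw [integral_finsetSum _ fun σ _ => integrable_finsetSum _ fun τ _ =>
    (integrable_prod_hermiteProduct _ _).const_mul _]
  have e : ∀ σ : Equiv.Perm (Fin N), (∫ x : Fin N → ℝ, ∑ τ : Equiv.Perm (Fin N),
      (((Equiv.Perm.sign σ : ℤ) : ℝ) * ((Equiv.Perm.sign τ : ℤ) : ℝ)) *
        ∏ i, hermiteProduct (σ i) (τ i) (x i)) = ∏ i : Fin N, monicHermite.normSq i := by
    intro σ
    rw [integral_finsetSum _ fun τ _ => (integrable_prod_hermiteProduct _ _).const_mul _]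
    simp only [integral_const_mul, integral_prod_hermiteProduct, hperm]
    rw [Finset.sum_eq_single σ (fun τ _ h => by simp [h.symm]) (by simp)]
    simp only [if_true, sign_mul_self_cast, one_mul]
    exact Equiv.prod_comp σ fun i : Fin N => monicHermite.normSq i
  simp [e, Fintype.card_perm]

lemma sum_perm_apply_zero {n : ℕ} (f : Fin (n + 1) → ℝ) :
    ((n + 1 : ℕ) : ℝ) * ∑ σ : Equiv.Perm (Fin (n + 1)), f (σ 0) = (n + 1).factorial * ∑ k, f k := by
  have h : ∀ i, ∑ σ : Equiv.Perm (Fin (n + 1)), f (σ i)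
      = ∑ σ : Equiv.Perm (Fin (n + 1)), f (σ 0) := by
    intro i
    refine Fintype.sum_equiv (Equiv.mulRight (Equiv.swap 0 i)) _ _ fun σ => ?_
    simp
  calc ((n + 1 : ℕ) : ℝ) * ∑ σ : Equiv.Perm (Fin (n + 1)), f (σ 0)
      = ∑ i : Fin (n + 1), ∑ σ : Equiv.Perm (Fin (n + 1)), f (σ i) := by simp [h]
    _ = ∑ σ : Equiv.Perm (Fin (n + 1)), ∑ k, f k := by
      rw [Finset.sum_comm]
      exact Finset.sum_congr rfl fun σ _ => Equiv.sum_comp σ f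
    _ = _ := by simp [Fintype.card_perm]

/-- Integrating out all variables but the first compares σ and τ only away from 0. The value at 0 is
the one left over, so again only diagonal pairs survive. -/
lemma perm_eq_of_eq_on_succ {n : ℕ} {σ τ : Equiv.Perm (Fin (n + 1))}
    (h : ∀ i : Fin n, σ i.succ = τ i.succ) : σ = τ := by
  have h1 : ∀ i, i ≠ 0 → (τ⁻¹ * σ) i = i := by
    intro i hi
    obtain ⟨j, rfl⟩ := Fin.exists_succ_eq.mpr hi
    simp [h]
  have h0 : (τ⁻¹ * σ) 0 = 0 := by
    by_contra hne
    exact hne ((τ⁻¹ * σ).injective (h1 _ hne))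
  have h2 : τ⁻¹ * σ = 1 := Equiv.ext fun i => by
    by_cases hi : i = 0
    · rw [hi, h0]; rfl
    · exact h1 i hi
  exact (inv_mul_eq_one.mp h2).symm

/-- The GUE density is the sum of the squares of the first `N` Hermite functions. -/
theorem gueDensity_eq_sum (N : ℕ) (x : ℝ) :
    gueDensity N x = ∑ k ∈ Finset.range N, hermiteProduct k k x / monicHermite.normSq k := by
  cases N with
  | zero => simp [gueDensity]
  | succ n =>
    have hperm : ∀ σ τ : Equiv.Perm (Fin (n + 1)),
        ((fun i : Fin n => ((σ i.succ : Fin (n + 1)) : ℕ)) = fun i => ((τ i.succ : Fin _) : ℕ))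
          ↔ σ = τ := by
      intro σ τ
      exact ⟨fun h => perm_eq_of_eq_on_succ fun i => Fin.ext (congrFun h i), fun h => by rw [h]⟩
    have hi : ∀ σ τ : Equiv.Perm (Fin (n + 1)), Integrable fun v : Fin n → ℝ =>
        (((Equiv.Perm.sign σ : ℤ) : ℝ) * ((Equiv.Perm.sign τ : ℤ) : ℝ)) *
        (hermiteProduct (σ 0) (τ 0) x * ∏ i : Fin n, hermiteProduct (σ i.succ) (τ i.succ) (v i)) :=
      fun σ τ => ((integrable_prod_hermiteProduct _ _).const_mul _).const_mul _
    have e : ∀ σ : Equiv.Perm (Fin (n + 1)), (∫ v : Fin n → ℝ, ∑ τ : Equiv.Perm (Fin (n + 1)),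
        (((Equiv.Perm.sign σ : ℤ) : ℝ) * ((Equiv.Perm.sign τ : ℤ) : ℝ)) *
        (hermiteProduct (σ 0) (τ 0) x * ∏ i : Fin n, hermiteProduct (σ i.succ) (τ i.succ) (v i)))
        = (∏ i : Fin (n + 1), monicHermite.normSq i) *
          (hermiteProduct (σ 0) (σ 0) x / monicHermite.normSq (σ 0)) := by
      intro σ
      rw [integral_finsetSum _ fun τ _ => hi σ τ]
      simp only [integral_const_mul, integral_prod_hermiteProduct, hperm]
      rw [Finset.sum_eq_single σ (fun τ _ h => by simp [h.symm]) (by simp)]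
      simp only [if_true, sign_mul_self_cast, one_mul]
      rw [← Equiv.prod_comp σ fun i : Fin (n + 1) => monicHermite.normSq i, Fin.prod_univ_succ]
      field_simp [(monicHermite.normSq_pos _).ne']
    have hmain : ∫ v : Fin n → ℝ, gueWeight (Fin.cons x v : Fin (n + 1) → ℝ)
        = (∏ i : Fin (n + 1), monicHermite.normSq i) * ∑ σ : Equiv.Perm (Fin (n + 1)),
          hermiteProduct (σ 0) (σ 0) x / monicHermite.normSq (σ 0) := by
      simp only [gueWeight_eq_sum_perm, Fin.prod_univ_succ, Fin.cons_zero, Fin.cons_succ]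
      rw [integral_finsetSum _ fun σ _ => integrable_finsetSum _ fun τ _ => hi σ τ]
      simp only [e, ← Finset.mul_sum, Fin.prod_univ_succ]
    have hP : (∏ i : Fin (n + 1), monicHermite.normSq i) ≠ 0 :=
      Finset.prod_ne_zero_iff.mpr fun i _ => (monicHermite.normSq_pos _).ne'
    have hf : ((n + 1).factorial : ℝ) ≠ 0 := by positivity
    have hs := sum_perm_apply_zero fun k : Fin (n + 1) =>
      hermiteProduct k k x / monicHermite.normSq k
    rw [gueDensity, hmain, gueNormalization_eq, ← Fin.sum_univ_eq_sum_range
      fun k => hermiteProduct k k x / monicHermite.normSq k]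
    field_simp
    linarith

/-! ### Integrals along vertical lines -/

/-- The point `a + i t` of the vertical line of abscissa `a`. -/
noncomputable def verticalLine (a t : ℝ) : ℂ := a + t * Complex.I

@[simp] lemma verticalLine_re (a t : ℝ) : (verticalLine a t).re = a := by simp [verticalLine]

@[simp] lemma verticalLine_im (a t : ℝ) : (verticalLine a t).im = t := by simp [verticalLine]

lemma continuous_verticalLine (a : ℝ) : Continuous (verticalLine a) := by
  unfold verticalLine; fun_prop

lemma hasDerivAt_verticalLine (a t : ℝ) : HasDerivAt (verticalLine a) Complex.I t := by
  have h := ((Complex.ofRealCLM.hasDerivAt (x := t)).mul_const Complex.I).const_add (a : ℂ)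
  simp only [Complex.ofRealCLM_apply, Complex.ofReal_one, one_mul] at h
  exact h

lemma norm_verticalLine_sq (a t : ℝ) : ‖verticalLine a t‖ ^ 2 = a ^ 2 + t ^ 2 := by
  rw [← Complex.normSq_eq_norm_sq, Complex.normSq_apply]
  simp
  ring

lemma le_norm_verticalLine (a t : ℝ) : a ≤ ‖verticalLine a t‖ := by
  simpa using Complex.re_le_norm (verticalLine a t)

lemma abs_le_norm_verticalLine (a t : ℝ) : |t| ≤ ‖verticalLine a t‖ := by
  simpa using Complex.abs_im_le_norm (verticalLine a t)

lemma integrable_norm_verticalLine_rpow {a : ℝ} (ha : 0 < a) :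
    Integrable fun t : ℝ => ‖verticalLine a t‖ ^ (-3 / 2 : ℝ) := by
  have hm : 0 < min (a ^ 2) 1 := by positivity
  have h := (integrable_rpow_neg_one_add_norm_sq (E := ℝ) (μ := volume) (r := 3 / 2)
    (by norm_num)).const_mul ((min (a ^ 2) 1) ^ (-3 / 4 : ℝ))
  refine h.mono' ?_ (Eventually.of_forall fun t => ?_)
  · exact (((continuous_verticalLine a).norm.measurable).pow_const _).aestronglyMeasurable
  · have h2 : min (a ^ 2) 1 * (1 + ‖t‖ ^ 2) ≤ ‖verticalLine a t‖ ^ 2 := by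
      rw [norm_verticalLine_sq, Real.norm_eq_abs, sq_abs]
      nlinarith [min_le_left (a ^ 2) 1, min_le_right (a ^ 2) 1, sq_nonneg t]
    rw [Real.norm_of_nonneg (by positivity),
      show (-(3 / 2) / 2 : ℝ) = -3 / 4 by norm_num, ← Real.mul_rpow hm.le (by positivity)]
    calc ‖verticalLine a t‖ ^ (-3 / 2 : ℝ) = (‖verticalLine a t‖ ^ 2) ^ (-3 / 4 : ℝ) := by
          rw [← Real.rpow_natCast, ← Real.rpow_mul (norm_nonneg _)]
          norm_num
      _ ≤ _ := Real.rpow_le_rpow_of_nonpos (by positivity) h2 (by norm_num)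

/-- A function on the right half plane that is `O(‖v‖ ^ (-3/2))` at infinity. -/
def DecaysOnHalfPlane (h : ℂ → ℂ) : Prop :=
  ∃ C : ℝ, ∀ v : ℂ, 0 < v.re → 2 ≤ ‖v‖ → ‖h v‖ ≤ C * ‖v‖ ^ (-3 / 2 : ℝ)

lemma DecaysOnHalfPlane.integrable {h : ℂ → ℂ} (hh : DecaysOnHalfPlane h) {a : ℝ} (ha : 0 < a)
    (hc : Continuous fun t : ℝ => h (verticalLine a t)) :
    Integrable fun t : ℝ => h (verticalLine a t) := by
  obtain ⟨C, hC⟩ := hh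
  refine hc.locallyIntegrable.integrable_of_isBigO_cocompact
    (g := fun t : ℝ => ‖verticalLine a t‖ ^ (-3 / 2 : ℝ)) ?_
    ((integrable_norm_verticalLine_rpow ha).integrableAtFilter _)
  refine IsBigO.of_bound C ?_
  have : ∀ᶠ t : ℝ in cocompact ℝ, 2 ≤ ‖t‖ :=
    (tendsto_norm_cocompact_atTop (E := ℝ)).eventually_ge_atTop 2
  filter_upwards [this] with t ht
  rw [Real.norm_of_nonneg (by positivity : 0 ≤ ‖verticalLine a t‖ ^ (-3 / 2 : ℝ))]
  exact hC _ (by simpa using ha) (ht.trans (abs_le_norm_verticalLine a t))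

lemma isOpen_rightHalfPlane : IsOpen {v : ℂ | 0 < v.re} :=
  isOpen_lt continuous_const Complex.continuous_re

lemma continuous_comp_verticalLine {h : ℂ → ℂ} (hd : DifferentiableOn ℂ h {v | 0 < v.re})
    {a : ℝ} (ha : 0 < a) : Continuous fun t : ℝ => h (verticalLine a t) :=
  hd.continuousOn.comp_continuous (continuous_verticalLine a) fun t => by simpa using ha

/-- The integral of a holomorphic function on the right half plane that decays like
`‖v‖ ^ (-3/2)` vanishes along every vertical line. -/
theorem integral_verticalLine_eq_zero {h : ℂ → ℂ} (hd : DifferentiableOn ℂ h {v | 0 < v.re})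
    (hh : DecaysOnHalfPlane h) {a : ℝ} (ha : 0 < a) : ∫ t : ℝ, h (verticalLine a t) = 0 := by
  have hint := hh.integrable ha (continuous_comp_verticalLine hd ha)
  obtain ⟨C, hC⟩ := hh
  have hlim := intervalIntegral_tendsto_integral hint tendsto_neg_atTop_atBot tendsto_id
  refine tendsto_nhds_unique hlim (squeeze_zero_norm' (a := fun T : ℝ => 4 * C * T ^ (-1 / 2 : ℝ))
    ?_ ?_)
  · filter_upwards [eventually_ge_atTop 2] with T hT
    have hT0 : 0 < T := by linarith
    have hb : ∀ v : ℂ, 0 < v.re → T ≤ ‖v‖ → ‖h v‖ ≤ C * T ^ (-3 / 2 : ℝ) := by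
      intro v hv hTv
      have hC0 : 0 ≤ C := by
        have := (norm_nonneg _).trans (hC v hv (hT.trans hTv))
        have hpos : 0 < ‖v‖ ^ (-3 / 2 : ℝ) := Real.rpow_pos_of_pos (by linarith) _
        exact nonneg_of_mul_nonneg_left this hpos
      refine (hC v hv (hT.trans hTv)).trans (mul_le_mul_of_nonneg_left ?_ hC0)
      exact Real.rpow_le_rpow_of_nonpos hT0 hTv (by norm_num)
    -- The rectangle has width T and height 2T: its other three sides have total length 4T, and on
    -- them the integrand is at most C T^(-3/2).
    have hrect := Complex.integral_boundary_rect_eq_zero_of_differentiableOn h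
      (⟨a, -T⟩ : ℂ) (⟨a + T, T⟩ : ℂ) (hd.mono fun v hv => by
        have := hv.1
        simp only [Set.mem_preimage, Set.uIcc_of_le (by linarith : a ≤ a + T), Set.mem_Icc] at this
        exact lt_of_lt_of_le ha this.1)
    simp only [smul_eq_mul] at hrect
    have h1 : ‖∫ x : ℝ in a..a + T, h (x + ((-T : ℝ) : ℂ) * Complex.I)‖
        ≤ C * T ^ (-3 / 2 : ℝ) * |a + T - a| := by
      refine intervalIntegral.norm_integral_le_of_norm_le_const fun x hx => hb _ ?_ ?_
      · rw [Set.uIoc_of_le (by linarith)] at hx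
        simpa using ha.trans hx.1
      · have := abs_le_norm_verticalLine x (-T)
        rwa [abs_neg, abs_of_pos hT0] at this
    have h2 : ‖∫ x : ℝ in a..a + T, h (x + (T : ℂ) * Complex.I)‖
        ≤ C * T ^ (-3 / 2 : ℝ) * |a + T - a| := by
      refine intervalIntegral.norm_integral_le_of_norm_le_const fun x hx => hb _ ?_ ?_
      · rw [Set.uIoc_of_le (by linarith)] at hx
        simpa using ha.trans hx.1
      · have := abs_le_norm_verticalLine x T
        rwa [abs_of_pos hT0] at this
    have h3 : ‖∫ y : ℝ in (-T)..T, h (((a + T : ℝ) : ℂ) + y * Complex.I)‖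
        ≤ C * T ^ (-3 / 2 : ℝ) * |T - -T| := by
      refine intervalIntegral.norm_integral_le_of_norm_le_const fun x _ => hb _ ?_ ?_
      · simp; positivity
      · exact le_trans (by linarith) (le_norm_verticalLine (a + T) x)
    rw [show a + T - a = T by ring, abs_of_pos hT0] at h1 h2
    rw [show T - -T = 2 * T by ring, abs_of_pos (by linarith)] at h3
    set A := ∫ x : ℝ in a..a + T, h (x + ((-T : ℝ) : ℂ) * Complex.I)
    set B := ∫ x : ℝ in a..a + T, h (x + (T : ℂ) * Complex.I)
    set D := ∫ y : ℝ in (-T)..T, h (((a + T : ℝ) : ℂ) + y * Complex.I)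
    have heq : Complex.I * (∫ t : ℝ in (-T)..T, h (verticalLine a t)) = A - B + Complex.I * D :=
      (sub_eq_zero.mp hrect).symm
    have hn := congrArg norm heq
    rw [norm_mul, Complex.norm_I, one_mul] at hn
    calc ‖∫ t : ℝ in (-T)..T, h (verticalLine a t)‖ = ‖A - B + Complex.I * D‖ := hn
      _ ≤ ‖A‖ + ‖B‖ + ‖D‖ := by
        refine (norm_add_le _ _).trans (add_le_add (norm_sub_le _ _) ?_)
        rw [norm_mul, Complex.norm_I, one_mul]
      _ ≤ 4 * C * (T ^ (-3 / 2 : ℝ) * T) := by linarith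
      _ = 4 * C * T ^ (-1 / 2 : ℝ) := by
        rw [← Real.rpow_add_one hT0.ne']
        norm_num
  · have := (tendsto_rpow_neg_atTop (y := 1 / 2) (by norm_num)).const_mul (4 * C)
    simpa [neg_div] using this

/-! ### A contour integral for the density -/

/-- The function `v ^ (-3/2) * exp (-X v)`. -/
noncomputable def contourKernel (X : ℝ) (v : ℂ) : ℂ := v ^ (-3 / 2 : ℂ) * Complex.exp (-(X * v))

/-- The Möbius transformation `(1 + v) / (1 - v)`. -/
noncomputable def moebius (v : ℂ) : ℂ := (1 + v) / (1 - v)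

/-! ### Bounds in the right half plane away from the pole v = 1. -/

lemma mem_slitPlane_of_re_pos {v : ℂ} (hv : 0 < v.re) : v ∈ Complex.slitPlane := Or.inl hv

lemma ne_zero_of_re_pos {v : ℂ} (hv : 0 < v.re) : v ≠ 0 := by
  rintro rfl; simp at hv

lemma one_add_ne_zero_of_re_pos {v : ℂ} (hv : 0 < v.re) : 1 + v ≠ 0 := by
  intro h
  have := congrArg Complex.re h
  simp at this
  linarith

lemma one_sub_verticalLine_ne_zero {a : ℝ} (ha : a < 1) (t : ℝ) : 1 - verticalLine a t ≠ 0 := by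
  intro h
  have := congrArg Complex.re h
  simp at this
  linarith

lemma norm_cpow_real_div (v : ℂ) (p : ℝ) {q : ℂ} (h : q = (p : ℂ)) : ‖v ^ q‖ = ‖v‖ ^ p := by
  rw [h, Complex.norm_cpow_real]

lemma norm_contourKernel_le {X : ℝ} (hX : 0 ≤ X) {v : ℂ} (hv : 0 < v.re) :
    ‖contourKernel X v‖ ≤ ‖v‖ ^ (-3 / 2 : ℝ) := by
  rw [contourKernel, norm_mul, norm_cpow_real_div v (-3 / 2) (by push_cast; ring), Complex.norm_exp]
  refine mul_le_of_le_one_right (by positivity) (Real.exp_le_one_iff.mpr ?_)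
  simp
  positivity

lemma hasDerivAt_contourKernel (X : ℝ) {v : ℂ} (hv : 0 < v.re) :
    HasDerivAt (contourKernel X) (contourKernel X v * (-3 / (2 * v) - X)) v := by
  have h0 := ne_zero_of_re_pos hv
  have h1 := (hasDerivAt_id v).cpow_const (c := (-3 / 2 : ℂ)) (mem_slitPlane_of_re_pos hv)
  have h2 := (((hasDerivAt_id v).const_mul (X : ℂ)).neg).cexp
  convert! h1.mul h2 using 1
  simp only [contourKernel, id, Pi.neg_apply]
  rw [Complex.cpow_sub _ _ h0, Complex.cpow_one]
  field_simp
  ring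

lemma decaysOnHalfPlane_contourKernel_mul {X : ℝ} (hX : 0 ≤ X) {B : ℂ → ℂ} {M : ℝ}
    (hB : ∀ v : ℂ, 0 < v.re → 2 ≤ ‖v‖ → ‖B v‖ ≤ M) :
    DecaysOnHalfPlane fun v => contourKernel X v * B v := by
  refine ⟨M, fun v hv hv2 => ?_⟩
  rw [norm_mul, mul_comm M]
  exact mul_le_mul (norm_contourKernel_le hX hv) (hB v hv hv2) (norm_nonneg _) (by positivity)

lemma norm_le_two_mul_norm_one_sub {v : ℂ} (hv : 2 ≤ ‖v‖) : ‖v‖ ≤ 2 * ‖1 - v‖ := by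
  have := norm_sub_norm_le v 1
  rw [norm_one, norm_sub_rev] at this
  linarith

lemma norm_le_norm_one_add {v : ℂ} (hv : 0 < v.re) : ‖v‖ ≤ ‖1 + v‖ := by
  refine abs_le_of_sq_le_sq' ?_ (norm_nonneg _) |>.2
  rw [← Complex.normSq_eq_norm_sq, ← Complex.normSq_eq_norm_sq, Complex.normSq_apply,
    Complex.normSq_apply]
  simp
  nlinarith

lemma norm_div_one_sub_le {v : ℂ} (hv : 2 ≤ ‖v‖) : ‖v / (1 - v)‖ ≤ 2 := by
  have h := norm_le_two_mul_norm_one_sub hv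
  rw [norm_div]
  exact div_le_of_le_mul₀ (norm_nonneg _) (by norm_num) h

lemma norm_div_one_add_le {v : ℂ} (hv : 0 < v.re) : ‖v / (1 + v)‖ ≤ 1 := by
  rw [norm_div]
  exact div_le_one_of_le₀ (norm_le_norm_one_add hv) (norm_nonneg _)

lemma norm_moebius_zpow_le {v : ℂ} (hv : 0 < v.re) (hv2 : 2 ≤ ‖v‖) (n : ℤ) :
    ‖moebius v ^ n‖ ≤ 3 ^ n.natAbs := by
  have h := norm_le_two_mul_norm_one_sub hv2
  have h' := norm_le_norm_one_add hv
  have h1 : ‖moebius v‖ ≤ 3 := by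
    rw [moebius, norm_div]
    refine div_le_of_le_mul₀ (norm_nonneg _) (by norm_num) ?_
    have := norm_add_le (1 : ℂ) v
    rw [norm_one] at this
    linarith
  have h2 : ‖(moebius v)⁻¹‖ ≤ 3 := by
    rw [moebius, inv_div, norm_div]
    refine div_le_of_le_mul₀ (norm_nonneg _) (by norm_num) ?_
    have := norm_sub_le (1 : ℂ) v
    rw [norm_one] at this
    linarith
  obtain ⟨k, rfl | rfl⟩ := n.eq_nat_or_neg
  · rw [zpow_natCast, norm_pow, Int.natAbs_natCast]
    exact pow_le_pow_left₀ (norm_nonneg _) h1 k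
  · rw [zpow_neg, ← inv_zpow, zpow_natCast, norm_pow, Int.natAbs_neg, Int.natAbs_natCast]
    exact pow_le_pow_left₀ (norm_nonneg _) h2 k

lemma moebius_verticalLine_ne_zero {a : ℝ} (ha : 0 < a) (ha1 : a < 1) (t : ℝ) :
    moebius (verticalLine a t) ≠ 0 :=
  div_ne_zero (one_add_ne_zero_of_re_pos (by simpa using ha)) (one_sub_verticalLine_ne_zero ha1 t)

lemma continuous_contourKernel_verticalLine (X : ℝ) {a : ℝ} (ha : 0 < a) :
    Continuous fun t : ℝ => contourKernel X (verticalLine a t) :=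
  continuous_comp_verticalLine (fun _ hv =>
    (hasDerivAt_contourKernel X hv).differentiableAt.differentiableWithinAt) ha

lemma continuous_moebius_verticalLine {a : ℝ} (ha1 : a < 1) :
    Continuous fun t : ℝ => moebius (verticalLine a t) :=
  (continuous_const.add (continuous_verticalLine a)).div
    (continuous_const.sub (continuous_verticalLine a)) (one_sub_verticalLine_ne_zero ha1)

lemma integrable_contourKernel_mul_moebius {X a : ℝ} (hX : 0 ≤ X) (ha : 0 < a) (ha1 : a < 1)
    (n : ℤ) : Integrable fun t : ℝ =>
      contourKernel X (verticalLine a t) * moebius (verticalLine a t) ^ n := by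
  refine DecaysOnHalfPlane.integrable
    (h := fun v => contourKernel X v * moebius v ^ n)
    (decaysOnHalfPlane_contourKernel_mul hX fun v hv hv2 => norm_moebius_zpow_le hv hv2 n) ha ?_
  exact (continuous_contourKernel_verticalLine X ha).mul
    ((continuous_moebius_verticalLine ha1).zpow₀ n
      fun t => Or.inl (moebius_verticalLine_ne_zero ha ha1 t))

/-- The integrand whose integral is proportional to the square of the `n`-th Hermite function. -/
noncomputable def hermiteIntegrand (X : ℝ) (n : ℤ) (v : ℂ) : ℂ :=
  contourKernel X v * (v / (1 - v) * moebius v ^ n)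

lemma integrable_hermiteIntegrand {X a : ℝ} (hX : 0 ≤ X) (ha : 0 < a) (ha1 : a < 1)
    (n : ℤ) : Integrable fun t : ℝ => hermiteIntegrand X n (verticalLine a t) := by
  refine DecaysOnHalfPlane.integrable (h := hermiteIntegrand X n)
    (decaysOnHalfPlane_contourKernel_mul (M := 2 * 3 ^ n.natAbs) hX fun v hv hv2 => ?_) ha ?_
  · rw [norm_mul]
    exact mul_le_mul (norm_div_one_sub_le hv2) (norm_moebius_zpow_le hv hv2 n) (norm_nonneg _)
      (by norm_num)
  · exact (continuous_contourKernel_verticalLine X ha).mul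
      (((continuous_verticalLine a).div (continuous_const.sub (continuous_verticalLine a))
        (one_sub_verticalLine_ne_zero ha1)).mul ((continuous_moebius_verticalLine ha1).zpow₀ n
        fun t => Or.inl (moebius_verticalLine_ne_zero ha ha1 t)))

/-- The integral of `hermiteIntegrand` along a vertical line. -/
noncomputable def hermiteIntegral (X a : ℝ) (n : ℤ) : ℂ :=
  ∫ t : ℝ, hermiteIntegrand X n (verticalLine a t)

/-- The derivative is the combination appearing in the recurrence for squared Hermite functions
(`hermiteSq_recurrence`), with X = x². Its integral over a line vanishes, which gives that
recurrence for the contour integrals. -/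
lemma hasDerivAt_hermiteIntegrand_primitive (X : ℝ) (n : ℤ) {v : ℂ} (hv : 0 < v.re)
    (hv1 : 1 - v ≠ 0) :
    HasDerivAt (fun v => contourKernel X v * (4 * (v / (1 + v)) ^ 2 * moebius v ^ (n + 1)))
      ((n + 1) * hermiteIntegrand X (n + 1) v + n * hermiteIntegrand X n v
        - n * hermiteIntegrand X (n - 1) v - (n - 1) * hermiteIntegrand X (n - 2) v
        - 2 * X * (hermiteIntegrand X n v - hermiteIntegrand X (n - 1) v)) v := by
  have h0 := ne_zero_of_re_pos hv
  have h1 := one_add_ne_zero_of_re_pos hv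
  have hm : moebius v ≠ 0 := div_ne_zero h1 hv1
  have hd1 : HasDerivAt (fun v : ℂ => 1 + v) 1 v := (hasDerivAt_id v).const_add 1
  have hd2 : HasDerivAt (fun v : ℂ => 1 - v) (-1) v := (hasDerivAt_id v).const_sub 1
  have hd3 : HasDerivAt moebius (2 / (1 - v) ^ 2) v := by
    convert! hd1.div hd2 hv1 using 1
    ring
  have hd4 := (hasDerivAt_zpow (n + 1) (moebius v) (Or.inl hm)).comp v hd3
  have hd5 := ((((hasDerivAt_id v).div hd1 h1).pow 2).const_mul (4 : ℂ))
  convert! (hasDerivAt_contourKernel X hv).mul (hd5.mul hd4) using 1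
  simp only [hermiteIntegrand, id, Function.comp_apply, Pi.pow_apply, Pi.div_apply, Pi.mul_apply]
  have e1 : moebius v ^ (n + 1) = moebius v ^ n * ((1 + v) / (1 - v)) := zpow_add_one₀ hm n
  have e2 : moebius v ^ (n - 1) = moebius v ^ n * ((1 - v) / (1 + v)) := by
    rw [zpow_sub_one₀ hm, moebius, inv_div]
  have e3 : moebius v ^ (n - 2) = moebius v ^ n * ((1 - v) / (1 + v)) ^ 2 := by
    rw [zpow_sub₀ hm, moebius]
    field_simp
  have e4 : moebius v ^ (n + 1 - 1) = moebius v ^ n := by rw [add_sub_cancel_right]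
  rw [e4, e1, e2, e3]
  generalize moebius v ^ n = ω
  generalize contourKernel X v = K
  push_cast
  field_simp
  ring

lemma hermiteIntegral_recurrence {X a : ℝ} (hX : 0 ≤ X) (ha : 0 < a) (ha1 : a < 1) (n : ℤ) :
    (n + 1) * hermiteIntegral X a (n + 1) + n * hermiteIntegral X a n
        - n * hermiteIntegral X a (n - 1) - (n - 1) * hermiteIntegral X a (n - 2)
        - 2 * X * (hermiteIntegral X a n - hermiteIntegral X a (n - 1)) = 0 := by
  have hi := fun n => integrable_hermiteIntegrand hX ha ha1 n
  have hd : ∀ t : ℝ, HasDerivAt (fun t => contourKernel X (verticalLine a t) *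
      (4 * (verticalLine a t / (1 + verticalLine a t)) ^ 2 * moebius (verticalLine a t) ^ (n + 1)))
      (((n + 1) * hermiteIntegrand X (n + 1) (verticalLine a t)
        + n * hermiteIntegrand X n (verticalLine a t)
        - n * hermiteIntegrand X (n - 1) (verticalLine a t)
        - (n - 1) * hermiteIntegrand X (n - 2) (verticalLine a t)
        - 2 * X * (hermiteIntegrand X n (verticalLine a t)
          - hermiteIntegrand X (n - 1) (verticalLine a t))) * Complex.I) t := fun t =>
    (hasDerivAt_hermiteIntegrand_primitive X n (by simpa using ha)
      (one_sub_verticalLine_ne_zero ha1 t)).comp t (hasDerivAt_verticalLine a t)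
  have hprim : Integrable fun t => contourKernel X (verticalLine a t) *
      (4 * (verticalLine a t / (1 + verticalLine a t)) ^ 2
        * moebius (verticalLine a t) ^ (n + 1)) := by
    refine DecaysOnHalfPlane.integrable
      (h := fun v => contourKernel X v * (4 * (v / (1 + v)) ^ 2 * moebius v ^ (n + 1)))
      (decaysOnHalfPlane_contourKernel_mul (M := 4 * 1 ^ 2 * 3 ^ (n + 1).natAbs) hX
        fun v hv hv2 => ?_) ha (continuous_iff_continuousAt.mpr fun t => (hd t).continuousAt)
    rw [norm_mul, norm_mul, norm_pow, Complex.norm_ofNat]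
    gcongr
    · exact norm_div_one_add_le hv
    · exact norm_moebius_zpow_le hv hv2 _
  have i1 := ((hi (n + 1)).const_mul ((n : ℂ) + 1)).fun_add ((hi n).const_mul (n : ℂ))
  have i2 := i1.sub' ((hi (n - 1)).const_mul (n : ℂ))
  have i3 := i2.sub' ((hi (n - 2)).const_mul ((n : ℂ) - 1))
  have i4 := ((hi n).sub' (hi (n - 1))).const_mul (2 * X : ℂ)
  have h := integral_eq_zero_of_hasDerivAt_of_integrable hd ((i3.sub' i4).mul_const _) hprim
  rw [integral_mul_const] at h
  have h' := (mul_eq_zero.mp h).resolve_right Complex.I_ne_zero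
  rw [integral_sub i3 i4, integral_sub i2 ((hi (n - 2)).const_mul ((n : ℂ) - 1)),
    integral_sub i1 ((hi (n - 1)).const_mul (n : ℂ)),
    integral_add ((hi (n + 1)).const_mul ((n : ℂ) + 1)) ((hi n).const_mul (n : ℂ)),
    integral_const_mul, integral_const_mul, integral_const_mul, integral_const_mul,
    integral_const_mul, integral_sub (hi n) (hi (n - 1))] at h'
  exact h'

/-! ### Starting values of the recurrence: indices -1, -2 and 0. -/

lemma differentiableOn_contourKernel (X : ℝ) :
    DifferentiableOn ℂ (contourKernel X) {v | 0 < v.re} := fun _ hv =>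
  (hasDerivAt_contourKernel X hv).differentiableAt.differentiableWithinAt

lemma differentiableOn_div_one_add : DifferentiableOn ℂ (fun v : ℂ => v / (1 + v)) {v | 0 < v.re} :=
  differentiableOn_id.div (differentiableOn_const 1 |>.add differentiableOn_id)
    fun _ hv => one_add_ne_zero_of_re_pos hv

/-- A negative power of the Möbius factor cancels the pole at v = 1, so the integrand is holomorphic
in the half plane and decays. The same holds for index -2. -/
lemma hermiteIntegral_neg_one {X a : ℝ} (hX : 0 ≤ X) (ha : 0 < a) (ha1 : a < 1) :
    hermiteIntegral X a (-1) = 0 := by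
  rw [← integral_verticalLine_eq_zero
    (h := fun v => contourKernel X v * (v / (1 + v)))
    ((differentiableOn_contourKernel X).mul differentiableOn_div_one_add)
    (decaysOnHalfPlane_contourKernel_mul hX fun v hv _ => norm_div_one_add_le hv) ha]
  refine integral_congr_ae (Eventually.of_forall fun t => ?_)
  have h1 := one_sub_verticalLine_ne_zero ha1 t
  have h2 := one_add_ne_zero_of_re_pos (v := verticalLine a t) (by simpa using ha)
  simp only [hermiteIntegrand, moebius, zpow_neg_one]
  field_simp

lemma hermiteIntegral_neg_two {X a : ℝ} (hX : 0 ≤ X) (ha : 0 < a) (ha1 : a < 1) :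
    hermiteIntegral X a (-2) = 0 := by
  rw [← integral_verticalLine_eq_zero
    (h := fun v => contourKernel X v * (v / (1 + v) * (2 / (1 + v) - 1)))
    ((differentiableOn_contourKernel X).mul (differentiableOn_div_one_add.mul
      (((differentiableOn_const 2).div (differentiableOn_const 1 |>.add differentiableOn_id)
        fun _ hv => one_add_ne_zero_of_re_pos hv).sub (differentiableOn_const 1))))
    (decaysOnHalfPlane_contourKernel_mul (M := 1 * 2) hX fun v hv hv2 => ?_) ha]
  · refine integral_congr_ae (Eventually.of_forall fun t => ?_)
    have h1 := one_sub_verticalLine_ne_zero ha1 t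
    have h2 := one_add_ne_zero_of_re_pos (v := verticalLine a t) (by simpa using ha)
    have e : moebius (verticalLine a t) ^ (-2 : ℤ) = ((moebius (verticalLine a t)) ^ 2)⁻¹ := by
      rw [zpow_neg]; norm_cast
    simp only [hermiteIntegrand, e]
    simp only [moebius]
    field_simp
    ring
  · rw [norm_mul]
    refine mul_le_mul (norm_div_one_add_le hv) ?_ (norm_nonneg _) zero_le_one
    refine (norm_sub_le _ _).trans ?_
    have h := norm_le_norm_one_add hv
    have : ‖2 / (1 + v)‖ ≤ 1 := by
      rw [norm_div, Complex.norm_ofNat]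
      exact div_le_one_of_le₀ (hv2.trans h) (norm_nonneg _)
    rw [norm_one]
    linarith

lemma integral_univ_div_sq_add_sq {b : ℝ} (hb : 0 < b) :
    ∫ t : ℝ, b / (b ^ 2 + t ^ 2) = Real.pi := by
  have h := Measure.integral_comp_div (fun x : ℝ => (1 + x ^ 2)⁻¹) b
  rw [integral_univ_inv_one_add_sq, abs_of_pos hb, smul_eq_mul] at h
  have e : ∀ t : ℝ, b / (b ^ 2 + t ^ 2) = b⁻¹ * (1 + (t / b) ^ 2)⁻¹ := by
    intro t
    have : b ^ 2 + t ^ 2 ≠ 0 := by positivity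
    field_simp
  simp only [e]
  rw [integral_const_mul, h]
  field_simp

lemma integrable_div_sq_add_sq {b : ℝ} (hb : 0 < b) :
    Integrable fun t : ℝ => b / (b ^ 2 + t ^ 2) := by
  by_contra h
  have := integral_univ_div_sq_add_sq hb
  rw [integral_undef h] at this
  exact Real.pi_ne_zero this.symm

lemma norm_one_add_mul_one_sub_verticalLine {a : ℝ} (ha : 0 < a) (t : ℝ) :
    (1 - a) ^ 2 + t ^ 2 ≤ ‖(1 + verticalLine a t) * (1 - verticalLine a t)‖ := by
  have h1 : ‖1 + verticalLine a t‖ ^ 2 = (1 + a) ^ 2 + t ^ 2 := by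
    rw [← norm_verticalLine_sq]
    congr 2
    simp [verticalLine]; ring
  have h2 : ‖1 - verticalLine a t‖ ^ 2 = (1 - a) ^ 2 + t ^ 2 := by
    rw [← neg_sq t, ← norm_verticalLine_sq]
    congr 2
    simp [verticalLine]; ring
  rw [norm_mul]
  have h3 : ‖1 - verticalLine a t‖ ≤ ‖1 + verticalLine a t‖ :=
    abs_le_of_sq_le_sq' (by rw [h1, h2]; nlinarith) (norm_nonneg _) |>.2
  rw [← h2, sq]
  exact mul_le_mul_of_nonneg_right h3 (norm_nonneg _)

lemma integrable_two_div_one_sub_sq {a : ℝ} (ha : 0 < a) (ha1 : a < 1) : Integrable fun t : ℝ =>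
    2 / ((1 + verticalLine a t) * (1 - verticalLine a t)) := by
  have hb : 0 < 1 - a := by linarith
  refine ((integrable_div_sq_add_sq hb).const_mul (2 / (1 - a))).mono' ?_
    (Eventually.of_forall fun t => ?_)
  · refine (continuous_const.div ((continuous_const.add (continuous_verticalLine a)).mul
      (continuous_const.sub (continuous_verticalLine a))) fun t => ?_).aestronglyMeasurable
    exact mul_ne_zero (one_add_ne_zero_of_re_pos (by simpa using ha))
      (one_sub_verticalLine_ne_zero ha1 t)
  · rw [norm_div, Complex.norm_ofNat,
      show 2 / (1 - a) * ((1 - a) / ((1 - a) ^ 2 + t ^ 2)) = 2 / ((1 - a) ^ 2 + t ^ 2) by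
        field_simp]
    exact div_le_div_of_nonneg_left (by norm_num) (by positivity)
      (norm_one_add_mul_one_sub_verticalLine ha t)

/-- The integrand is 1/(1+v) + 1/(1-v). Pairing t with -t leaves real Cauchy densities of widths 1 -
a and 1 + a, each with integral π. -/
lemma integral_two_div_one_sub_sq {a : ℝ} (ha : 0 < a) (ha1 : a < 1) :
    ∫ t : ℝ, 2 / ((1 + verticalLine a t) * (1 - verticalLine a t)) = 2 * Real.pi := by
  have hi := integrable_two_div_one_sub_sq ha ha1
  have hb : 0 < 1 - a := by linarith
  have hb' : 0 < 1 + a := by linarith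
  set k : ℝ → ℂ := fun t => 2 / ((1 + verticalLine a t) * (1 - verticalLine a t)) with hk
  have hneg : ∫ t : ℝ, k (-t) = ∫ t : ℝ, k t := integral_neg_eq_self k volume
  have hsum : ∀ t : ℝ, k t + k (-t) = ((2 * ((1 - a) / ((1 - a) ^ 2 + t ^ 2)
      + (1 + a) / ((1 + a) ^ 2 + t ^ 2)) : ℝ) : ℂ) := by
    intro t
    have h1 := one_sub_verticalLine_ne_zero ha1 t
    have h2 := one_add_ne_zero_of_re_pos (v := verticalLine a t) (by simpa using ha)
    have h3 := one_sub_verticalLine_ne_zero ha1 (-t)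
    have h4 := one_add_ne_zero_of_re_pos (v := verticalLine a (-t)) (by simpa using ha)
    have e1 : ((1 - a : ℂ) ^ 2 + t ^ 2) = (1 - verticalLine a t) * (1 - verticalLine a (-t)) := by
      simp only [verticalLine]; push_cast
      linear_combination ((t : ℂ) ^ 2) * Complex.I_sq
    have e2 : ((1 + a : ℂ) ^ 2 + t ^ 2) = (1 + verticalLine a t) * (1 + verticalLine a (-t)) := by
      simp only [verticalLine]; push_cast
      linear_combination ((t : ℂ) ^ 2) * Complex.I_sq
    have e3 : (2 * a : ℂ) = verticalLine a t + verticalLine a (-t) := by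
      simp only [verticalLine]; push_cast; ring
    simp only [hk]
    push_cast
    rw [e1, e2]
    have e4 : (a : ℂ) = (verticalLine a t + verticalLine a (-t)) / 2 := by rw [← e3]; ring
    generalize verticalLine a t = v at *
    generalize verticalLine a (-t) = w at *
    rw [e4]
    field_simp
    ring
  have h2 : (∫ t : ℝ, k t) + ∫ t : ℝ, k (-t) = ((4 * Real.pi : ℝ) : ℂ) := by
    rw [← integral_add hi hi.comp_neg]
    simp only [hsum]
    rw [integral_complex_ofReal, integral_const_mul, integral_add (integrable_div_sq_add_sq hb)
      (integrable_div_sq_add_sq hb'), integral_univ_div_sq_add_sq hb, integral_univ_div_sq_add_sq hb']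
    congr 1
    ring
  rw [hneg] at h2
  push_cast at h2
  linear_combination h2 / 2

/-- This is the residue at v = 1, computed by subtraction. The function 2/(1+v) equals 1 there and
decays, so removing exp(-X) times it from the numerator leaves a quotient (`dslope`) that is
holomorphic with the decay needed for a zero integral; only an explicit rational integral remains.
-/
lemma hermiteIntegral_zero {X a : ℝ} (hX : 0 ≤ X) (ha : 0 < a) (ha1 : a < 1) :
    hermiteIntegral X a 0 = 2 * Real.pi * Real.exp (-X) := by
  set φ : ℂ → ℂ := fun v => contourKernel X v * v - Real.exp (-X) * (2 / (1 + v)) with hφ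
  have hφd : DifferentiableOn ℂ φ {v | 0 < v.re} :=
    ((differentiableOn_contourKernel X).mul differentiableOn_id).sub
      (((differentiableOn_const 2).div (differentiableOn_const 1 |>.add differentiableOn_id)
        fun _ hv => one_add_ne_zero_of_re_pos hv).const_mul _)
  have hφ1 : φ 1 = 0 := by
    simp only [hφ, contourKernel, Complex.one_cpow]
    norm_num
  have hds : ∀ v : ℂ, v ≠ 1 → dslope φ 1 v = φ v / (v - 1) := by
    intro v hv
    rw [dslope_of_ne _ hv, slope_def_field, hφ1, sub_zero]
  have hdd : DifferentiableOn ℂ (dslope φ 1) {v | 0 < v.re} :=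
    (Complex.differentiableOn_dslope (isOpen_rightHalfPlane.mem_nhds (by simp))).mpr hφd
  have hdec : DecaysOnHalfPlane (dslope φ 1) := by
    refine ⟨6, fun v hv hv2 => ?_⟩
    have hv1 : v ≠ 1 := by
      rintro rfl
      norm_num at hv2
    have hs := norm_le_two_mul_norm_one_sub hv2
    have hn : 0 < ‖v‖ := by linarith
    have hs0 : 0 < ‖1 - v‖ := by linarith
    have h1 : ‖contourKernel X v * v‖ ≤ ‖v‖ ^ (-1 / 2 : ℝ) := by
      rw [norm_mul, show (-1 / 2 : ℝ) = -3 / 2 + 1 by norm_num, Real.rpow_add_one hn.ne']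
      exact mul_le_mul_of_nonneg_right (norm_contourKernel_le hX hv) hn.le
    have h2 : ‖(Real.exp (-X) : ℂ) * (2 / (1 + v))‖ ≤ 2 * ‖v‖ ^ (-1 / 2 : ℝ) := by
      rw [norm_mul, norm_div, Complex.norm_ofNat, Complex.norm_real,
        Real.norm_of_nonneg (Real.exp_pos _).le]
      have h3 : Real.exp (-X) ≤ 1 := Real.exp_le_one_iff.mpr (by linarith)
      have h4 : 2 / ‖1 + v‖ ≤ 2 * ‖v‖ ^ (-1 / 2 : ℝ) := by
        rw [div_eq_mul_inv]
        refine mul_le_mul_of_nonneg_left ?_ (by norm_num)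
        calc ‖1 + v‖⁻¹ ≤ ‖v‖⁻¹ := inv_anti₀ hn (norm_le_norm_one_add hv)
          _ = ‖v‖ ^ (-1 : ℝ) := (Real.rpow_neg_one _).symm
          _ ≤ _ := Real.rpow_le_rpow_of_exponent_le (by linarith) (by norm_num)
      have h5 : 0 ≤ 2 / ‖1 + v‖ := by positivity
      nlinarith
    rw [hds v hv1, norm_div, norm_sub_rev v 1]
    have h3 : ‖φ v‖ ≤ 3 * ‖v‖ ^ (-1 / 2 : ℝ) := (norm_sub_le _ _).trans (by linarith)
    rw [div_le_iff₀ hs0]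
    calc ‖φ v‖ ≤ 3 * ‖v‖ ^ (-1 / 2 : ℝ) := h3
      _ = 3 * ‖v‖ ^ (-3 / 2 : ℝ) * ‖v‖ := by
        rw [show (-1 / 2 : ℝ) = -3 / 2 + 1 by norm_num, Real.rpow_add_one hn.ne', mul_assoc]
      _ ≤ 3 * ‖v‖ ^ (-3 / 2 : ℝ) * (2 * ‖1 - v‖) :=
        mul_le_mul_of_nonneg_left hs (by positivity)
      _ = _ := by ring
  have h0 := integral_verticalLine_eq_zero hdd hdec ha
  have he : ∀ t : ℝ, hermiteIntegrand X 0 (verticalLine a t) = Real.exp (-X) *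
      (2 / ((1 + verticalLine a t) * (1 - verticalLine a t))) - dslope φ 1 (verticalLine a t) := by
    intro t
    have h1 := one_sub_verticalLine_ne_zero ha1 t
    have h2 := one_add_ne_zero_of_re_pos (v := verticalLine a t) (by simpa using ha)
    have h3 : verticalLine a t - 1 ≠ 0 := by rw [← neg_sub]; exact neg_ne_zero.mpr h1
    rw [hds _ (sub_ne_zero.mp h3), hermiteIntegrand, zpow_zero, mul_one, hφ]
    rw [show verticalLine a t - 1 = -(1 - verticalLine a t) by ring]
    field_simp
    ring
  rw [hermiteIntegral]
  simp only [he]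
  rw [integral_sub ((integrable_two_div_one_sub_sq ha ha1).const_mul _)
    (hdec.integrable ha (continuous_comp_verticalLine hdd ha)), h0, integral_const_mul,
    integral_two_div_one_sub_sq ha ha1]
  ring

/-- The square of the `n`-th normalised Hermite function. -/
noncomputable def hermiteSq (n : ℕ) (x : ℝ) : ℝ := hermiteProduct n n x / monicHermite.normSq n

/-! ### The matching recurrence for squared Hermite functions. -/

lemma monicHermite.normSq_succ (n : ℕ) : normSq (n + 1) = normSq n * ((n + 1) / 2) := by
  simp only [normSq, Nat.factorial_succ, pow_succ]
  push_cast
  field_simp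

lemma hermiteSq_zero (x : ℝ) : hermiteSq 0 x = Real.exp (-x ^ 2) / √Real.pi := by
  simp [hermiteSq, hermiteProduct, monicHermite, monicHermite.normSq]

lemma hermiteSq_one (x : ℝ) : hermiteSq 1 x = 2 * x ^ 2 * hermiteSq 0 x := by
  simp [hermiteSq, hermiteProduct, monicHermite, monicHermite.normSq]
  field_simp

lemma hermiteSq_two (x : ℝ) :
    2 * hermiteSq 2 x + hermiteSq 1 x - hermiteSq 0 x
      = 2 * x ^ 2 * (hermiteSq 1 x - hermiteSq 0 x) := by
  simp [hermiteSq, hermiteProduct, monicHermite.eval_succ_succ, monicHermite.normSq,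
    Nat.factorial]
  simp [monicHermite]
  field_simp
  ring

/-- Squares of solutions of a three-term recurrence satisfy a four-term one. This is
`hermiteIntegral_recurrence` at index n + 2; `hermiteSq_one` and `hermiteSq_two` are its cases 0 and
1 with the negative-index terms dropped. -/
lemma hermiteSq_recurrence (n : ℕ) (x : ℝ) :
    (n + 3) * hermiteSq (n + 3) x + (n + 2) * hermiteSq (n + 2) x - (n + 2) * hermiteSq (n + 1) x
      - (n + 1) * hermiteSq n x = 2 * x ^ 2 * (hermiteSq (n + 2) x - hermiteSq (n + 1) x) := by
  have h := (monicHermite.normSq_pos n).ne'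
  simp only [hermiteSq, hermiteProduct, monicHermite.normSq_succ,
    monicHermite.eval_succ_succ]
  push_cast
  have h1 : (n : ℝ) + 1 ≠ 0 := by positivity
  have h2 : (n : ℝ) + 1 + 1 ≠ 0 := by positivity
  have h3 : (n : ℝ) + 1 + 1 + 1 ≠ 0 := by positivity
  have h4 : (n : ℝ) + 2 + 1 ≠ 0 := by positivity
  field_simp
  ring

lemma hermiteIntegral_eq {a : ℝ} (ha : 0 < a) (ha1 : a < 1) (x : ℝ) (n : ℕ) :
    hermiteIntegral (x ^ 2) a n = 2 * Real.pi * √Real.pi * hermiteSq n x := by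
  have hX : 0 ≤ x ^ 2 := sq_nonneg x
  have hpi : (√Real.pi : ℂ) ≠ 0 := by
    exact_mod_cast (Real.sqrt_pos.mpr Real.pi_pos).ne'
  have hr := hermiteIntegral_recurrence hX ha ha1
  have h0 : hermiteIntegral (x ^ 2) a (0 : ℕ) = 2 * Real.pi * √Real.pi * hermiteSq 0 x := by
    rw [hermiteSq_zero, Nat.cast_zero, hermiteIntegral_zero hX ha ha1]
    push_cast
    field_simp
  have h1 : hermiteIntegral (x ^ 2) a (1 : ℕ) = 2 * Real.pi * √Real.pi * hermiteSq 1 x := by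
    have h := hr 0
    have e : (0 : ℤ) - 2 = -2 := rfl
    have e' : (0 : ℤ) - 1 = -1 := rfl
    rw [e, e', hermiteIntegral_neg_one hX ha ha1, hermiteIntegral_neg_two hX ha ha1] at h
    rw [hermiteSq_one]
    push_cast at h0 h ⊢
    rw [h0] at h
    simp only [zero_add] at h
    linear_combination h
  have h2 : hermiteIntegral (x ^ 2) a (2 : ℕ) = 2 * Real.pi * √Real.pi * hermiteSq 2 x := by
    have h := hr 1
    have e := congrArg (fun z : ℝ => (z : ℂ)) (hermiteSq_two x)
    have e1 : (1 : ℤ) - 1 = (0 : ℕ) := rfl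
    have e2 : (1 : ℤ) + 1 = (2 : ℕ) := rfl
    have e3 : (1 : ℤ) = (1 : ℕ) := rfl
    rw [e1, e2, e3, h0, h1] at h
    push_cast at h e ⊢
    linear_combination h / 2 - Real.pi * √Real.pi * e
  suffices H : ∀ n : ℕ,
      hermiteIntegral (x ^ 2) a n = 2 * Real.pi * √Real.pi * hermiteSq n x ∧
      hermiteIntegral (x ^ 2) a (n + 1 : ℕ) = 2 * Real.pi * √Real.pi * hermiteSq (n + 1) x ∧
      hermiteIntegral (x ^ 2) a (n + 2 : ℕ) = 2 * Real.pi * √Real.pi * hermiteSq (n + 2) x from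
    (H n).1
  intro n
  induction n with
  | zero => exact ⟨h0, h1, h2⟩
  | succ n ih =>
    obtain ⟨i0, i1, i2⟩ := ih
    refine ⟨i1, i2, ?_⟩
    have h := hr ((n + 2 : ℕ) : ℤ)
    have e := congrArg (fun z : ℝ => (z : ℂ)) (hermiteSq_recurrence n x)
    rw [show ((n + 2 : ℕ) : ℤ) + 1 = (n + 3 : ℕ) by push_cast; ring,
      show ((n + 2 : ℕ) : ℤ) - 1 = (n + 1 : ℕ) by push_cast; ring,
      show ((n + 2 : ℕ) : ℤ) - 2 = (n : ℕ) by push_cast; ring, i0, i1, i2] at h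
    have h3 : (n : ℂ) + 3 ≠ 0 := by exact_mod_cast (by omega : n + 3 ≠ 0)
    rw [show n + 1 + 2 = n + 3 by ring]
    refine mul_left_cancel₀ h3 ?_
    push_cast at h e ⊢
    linear_combination h - 2 * Real.pi * √Real.pi * e

/-- The GUE density as a contour integral along a vertical line. -/
theorem gueDensity_eq_integral {a : ℝ} (ha : 0 < a) (ha1 : a < 1) (N : ℕ) (x : ℝ) :
    4 * Real.pi * √Real.pi * gueDensity N x = ∫ t : ℝ,
      contourKernel (x ^ 2) (verticalLine a t) * moebius (verticalLine a t) ^ N := by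
  have hX : 0 ≤ x ^ 2 := sq_nonneg x
  have hi := fun n : ℕ => integrable_contourKernel_mul_moebius hX ha ha1 n
  simp only [zpow_natCast] at hi
  rw [gueDensity_eq_sum]
  induction N with
  | zero =>
    simp only [pow_zero]
    rw [integral_verticalLine_eq_zero (h := fun v => contourKernel (x ^ 2) v * 1)
      ((differentiableOn_contourKernel _).mul (differentiableOn_const 1))
      (decaysOnHalfPlane_contourKernel_mul (M := 1) hX fun v _ _ => by simp) ha]
    simp
  | succ n ih =>
    rw [Finset.sum_range_succ]
    push_cast at ih ⊢
    have h := hermiteIntegral_eq ha ha1 x n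
    -- Telescoping: the Möbius factor minus 1 is 2v/(1-v).
    have hstep : ∀ t : ℝ, contourKernel (x ^ 2) (verticalLine a t) * moebius (verticalLine a t) ^
        (n + 1) = contourKernel (x ^ 2) (verticalLine a t) * moebius (verticalLine a t) ^ n
          + 2 * hermiteIntegrand (x ^ 2) n (verticalLine a t) := by
      intro t
      have h1 := one_sub_verticalLine_ne_zero ha1 t
      rw [hermiteIntegrand, zpow_natCast, pow_succ (moebius _) n]
      generalize moebius (verticalLine a t) ^ n = ω
      rw [moebius]
      field_simp
      ring
    simp only [hstep]
    rw [integral_add (hi n) ((integrable_hermiteIntegrand hX ha ha1 n).const_mul 2),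
      integral_const_mul, ← ih]
    rw [hermiteIntegral] at h
    rw [h, hermiteSq]
    push_cast
    ring

/-! ### Estimates for the contour integrand in soft edge scaling -/

/-- The modulus is largest at t = 0. Dividing out that maximum leaves exactly 1 - u, and 1 - u ≤
exp(-u) makes the decay multiplicative under N-th powers. -/
lemma norm_moebius_verticalLine_sq_le {a : ℝ} (ha : 0 < a) (ha1 : a ≤ 1 / 2) (t : ℝ) :
    ‖moebius (verticalLine a t)‖ ^ 2
      ≤ ((1 + a) / (1 - a)) ^ 2 * Real.exp (-(a * t ^ 2 / (1 + t ^ 2))) := by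
  have hb : 0 < 1 - a := by linarith
  have h1 : ‖1 + verticalLine a t‖ ^ 2 = (1 + a) ^ 2 + t ^ 2 := by
    rw [← norm_verticalLine_sq]
    congr 2
    simp [verticalLine]; ring
  have h2 : ‖1 - verticalLine a t‖ ^ 2 = (1 - a) ^ 2 + t ^ 2 := by
    rw [← neg_sq t, ← norm_verticalLine_sq]
    congr 2
    simp [verticalLine]; ring
  have hu : 1 - 4 * a * t ^ 2 / ((1 + a) ^ 2 * ((1 - a) ^ 2 + t ^ 2))
      ≤ Real.exp (-(a * t ^ 2 / (1 + t ^ 2))) := by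
    refine le_trans ?_ (Real.one_sub_le_exp_neg _)
    refine sub_le_sub_left ?_ 1
    rw [div_le_div_iff₀ (by positivity) (by positivity)]
    have e1 : (1 + a) ^ 2 * ((1 - a) ^ 2 + t ^ 2) ≤ 4 * (1 + t ^ 2) := by
      have : (1 + a) ^ 2 ≤ 4 := by nlinarith
      have : (1 - a) ^ 2 + t ^ 2 ≤ 1 + t ^ 2 := by nlinarith
      gcongr
    calc a * t ^ 2 * ((1 + a) ^ 2 * ((1 - a) ^ 2 + t ^ 2)) ≤ a * t ^ 2 * (4 * (1 + t ^ 2)) :=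
          mul_le_mul_of_nonneg_left e1 (by positivity)
      _ = _ := by ring
  rw [moebius, norm_div, div_pow, h1, h2]
  calc ((1 + a) ^ 2 + t ^ 2) / ((1 - a) ^ 2 + t ^ 2)
      = ((1 + a) / (1 - a)) ^ 2 *
        (1 - 4 * a * t ^ 2 / ((1 + a) ^ 2 * ((1 - a) ^ 2 + t ^ 2))) := by
        have : (1 - a) ^ 2 + t ^ 2 ≠ 0 := by positivity
        field_simp
        ring
    _ ≤ _ := mul_le_mul_of_nonneg_left hu (by positivity)

/-- The quadratic terms of log(1+a) and log(1-a) cancel; each cubic remainder is at most a³/(1-a) ≤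
2a³. -/
lemma one_add_div_one_sub_le_exp {a : ℝ} (ha : 0 < a) (ha1 : a ≤ 1 / 2) :
    (1 + a) / (1 - a) ≤ Real.exp (2 * a + 4 * a ^ 3) := by
  have hb : 0 < 1 - a := by linarith
  have h1 := Real.abs_log_sub_add_sum_range_le (x := a) (by rw [abs_of_pos ha]; linarith) 2
  have h2 := Real.abs_log_sub_add_sum_range_le (x := -a) (by rw [abs_neg, abs_of_pos ha]; linarith) 2
  rw [abs_neg] at h2
  rw [abs_of_pos ha] at h1 h2
  have h3 : a ^ 3 / (1 - a) ≤ 2 * a ^ 3 := by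
    rw [div_le_iff₀ hb]
    nlinarith [pow_pos ha 3]
  simp only [Finset.sum_range_succ, Finset.sum_range_zero, sub_neg_eq_add] at h1 h2
  norm_num at h1 h2
  have h1' := (abs_le.mp h1).1
  have h2' := (abs_le.mp h2).2
  rw [← Real.exp_log (show 0 < (1 + a) / (1 - a) by positivity),
    Real.log_div (by positivity) (by positivity)]
  exact Real.exp_le_exp.mpr (by linarith)

/-- The square of the soft edge variable, as a function of the scale `δ`. -/
noncomputable def softEdgeSq (δ y : ℝ) : ℝ := 1 / (4 * δ ^ 3) + y / δ + δ * y ^ 2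

lemma ofReal_mul_verticalLine (δ c τ : ℝ) :
    (δ : ℂ) * verticalLine c τ = verticalLine (δ * c) (δ * τ) := by
  simp only [verticalLine]; push_cast; ring

/-- A crude bound on the whole line, for use where Taylor expansion fails. The divergent factors
exp(±c/(4δ²)) cancel. What remains is Gaussian for |δτ| ≤ 1 and a constant exponentially small in
δ^(-2) beyond. -/
lemma norm_exp_mul_moebius_pow_le {c δ y : ℝ} {N : ℕ} (hc : 0 < c) (hδ : 0 < δ)
    (hN : (N : ℝ) * (8 * δ ^ 3) = 1) (hδc : δ * c ≤ 1 / 2) (τ : ℝ) :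
    ‖Complex.exp (-(softEdgeSq δ y * (δ * verticalLine c τ)))
        * moebius (δ * verticalLine c τ) ^ N‖
      ≤ Real.exp (c ^ 3 / 2 - y * c)
        * (Real.exp (-(c / 32 * τ ^ 2)) + Real.exp (-(c / (32 * δ ^ 2)))) := by
  have ha : 0 < δ * c := by positivity
  have hNe : (N : ℝ) = 1 / (8 * δ ^ 3) := by field_simp; linarith
  have h1 : ‖moebius (δ * verticalLine c τ)‖ ^ N ≤ ((1 + δ * c) / (1 - δ * c)) ^ N *
      Real.exp (-(c * τ ^ 2 / (16 * (1 + (δ * τ) ^ 2)))) := by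
    have hb : 0 < 1 - δ * c := by linarith
    refine abs_le_of_sq_le_sq' ?_ (by positivity) |>.2
    rw [ofReal_mul_verticalLine, ← pow_mul, mul_comm N 2, pow_mul]
    refine (pow_le_pow_left₀ (by positivity)
      (norm_moebius_verticalLine_sq_le ha hδc (δ * τ)) N).trans (le_of_eq ?_)
    rw [mul_pow (_ ^ 2) _ N, mul_pow (_ ^ N) _ 2, ← pow_mul, ← pow_mul, mul_comm 2 N,
      ← Real.exp_nat_mul,
      ← Real.exp_nat_mul, hNe]
    congr 2
    push_cast
    have : 1 + (δ * τ) ^ 2 ≠ 0 := by positivity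
    field_simp
    ring
  have h2 : ((1 + δ * c) / (1 - δ * c)) ^ N ≤ Real.exp (c / (4 * δ ^ 2) + c ^ 3 / 2) := by
    have hb : 0 < 1 - δ * c := by linarith
    refine (pow_le_pow_left₀ (by positivity) (one_add_div_one_sub_le_exp ha hδc) N).trans
      (le_of_eq ?_)
    rw [← Real.exp_nat_mul, hNe]
    congr 1
    field_simp
    norm_num
  have h3 : ‖Complex.exp (-(softEdgeSq δ y * (δ * verticalLine c τ)))‖
      ≤ Real.exp (-(c / (4 * δ ^ 2)) - y * c) := by
    rw [Complex.norm_exp]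
    refine Real.exp_le_exp.mpr ?_
    have e : (-((softEdgeSq δ y : ℂ) * (δ * verticalLine c τ))).re
        = -(c / (4 * δ ^ 2)) - y * c - δ ^ 2 * y ^ 2 * c := by
      rw [ofReal_mul_verticalLine, Complex.neg_re, Complex.re_ofReal_mul, verticalLine_re,
        softEdgeSq]
      field_simp
      ring
    rw [e]
    have : 0 ≤ δ ^ 2 * y ^ 2 * c := by positivity
    linarith
  have h4 : Real.exp (-(c * τ ^ 2 / (16 * (1 + (δ * τ) ^ 2))))
      ≤ Real.exp (-(c / 32 * τ ^ 2)) + Real.exp (-(c / (32 * δ ^ 2))) := by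
    rcases le_total ((δ * τ) ^ 2) 1 with h | h
    · refine le_add_of_le_of_nonneg (Real.exp_le_exp.mpr (neg_le_neg ?_)) (Real.exp_pos _).le
      rw [le_div_iff₀ (by positivity)]
      nlinarith [mul_nonneg hc.le (sq_nonneg τ)]
    · refine le_add_of_nonneg_of_le (Real.exp_pos _).le (Real.exp_le_exp.mpr (neg_le_neg ?_))
      rw [div_le_div_iff₀ (by positivity) (by positivity)]
      nlinarith
  rw [norm_mul, norm_pow]
  calc _ ≤ Real.exp (-(c / (4 * δ ^ 2)) - y * c) * (Real.exp (c / (4 * δ ^ 2) + c ^ 3 / 2) *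
        (Real.exp (-(c / 32 * τ ^ 2)) + Real.exp (-(c / (32 * δ ^ 2))))) := by
        refine mul_le_mul h3 (h1.trans ?_) (by positivity) (by positivity)
        exact mul_le_mul h2 h4 (by positivity) (by positivity)
    _ = _ := by
        rw [← mul_assoc, ← Real.exp_add]
        congr 2
        ring

/-- The coefficients of the expansion of the contour integrand in the parameter `δ²`. -/
noncomputable def softEdgePoly (y : ℝ) (s : ℂ) : ℕ → ℂ
  | 0 => 1
  | 1 => s ^ 5 / 20 - y ^ 2 * s
  | 2 => s ^ 7 / 28 + (s ^ 5 / 20 - y ^ 2 * s) ^ 2 / 2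
  | _ => 0

/-- Taylor polynomials of degree 8 are used for both logarithms: the even terms cancel, so the first
omitted power is the ninth. -/
lemma norm_log_one_add_sub_log_one_sub_le {v : ℂ} (hv : ‖v‖ ≤ 1 / 2) :
    ‖Complex.log (1 + v) - Complex.log (1 - v)
      - (2 * v + 2 * v ^ 3 / 3 + 2 * v ^ 5 / 5 + 2 * v ^ 7 / 7)‖ ≤ ‖v‖ ^ 9 := by
  have h1 := Complex.norm_log_sub_logTaylor_le 8 (z := v) (by linarith)
  have h2 := Complex.norm_log_sub_logTaylor_le 8 (z := -v) (by rw [norm_neg]; linarith)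
  rw [norm_neg] at h2
  have hinv : (1 - ‖v‖)⁻¹ ≤ 2 := by
    rw [inv_le_comm₀ (by linarith) (by norm_num)]
    linarith
  have h3 : ‖v‖ ^ (8 + 1) * (1 - ‖v‖)⁻¹ / ((8 : ℕ) + 1) ≤ ‖v‖ ^ 9 / 4 := by
    have := mul_le_mul_of_nonneg_left hinv (pow_nonneg (norm_nonneg v) 9)
    have h9 := pow_nonneg (norm_nonneg v) 9
    push_cast
    rw [div_le_div_iff₀ (by norm_num) (by norm_num)]
    linarith
  have e : Complex.log (1 + v) - Complex.log (1 - v)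
      - (2 * v + 2 * v ^ 3 / 3 + 2 * v ^ 5 / 5 + 2 * v ^ 7 / 7)
      = (Complex.log (1 + v) - Complex.logTaylor (8 + 1) v)
        - (Complex.log (1 + -v) - Complex.logTaylor (8 + 1) (-v)) := by
    simp only [Complex.logTaylor, Finset.sum_range_succ, Finset.sum_range_zero, ← sub_eq_add_neg]
    push_cast
    ring
  rw [e]
  refine (norm_sub_le _ _).trans ?_
  have h9 := pow_nonneg (norm_nonneg v) 9
  linarith

/-- With N = 1/(8δ³), the linear term 2Nδs of the logarithm cancels the leading part s/(4δ²) of x²v,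
and the cubic term becomes the Airy phase s³/12. -/
lemma exp_mul_moebius_pow_eq {δ y : ℝ} {N : ℕ} (hδ : 0 < δ)
    (hN : (N : ℝ) * (8 * δ ^ 3) = 1) {s : ℂ} (hs : ‖(δ : ℂ) * s‖ ≤ 1 / 2) :
    ∃ ρ : ℂ, ‖ρ‖ ≤ (δ ^ 2) ^ 3 * ‖s‖ ^ 9 ∧
      Complex.exp (-(softEdgeSq δ y * (δ * s))) * moebius (δ * s) ^ N
        = Complex.exp (s ^ 3 / 12 - y * s) *
          Complex.exp ((δ ^ 2 : ℝ) * (s ^ 5 / 20 - y ^ 2 * s) + (δ ^ 2 : ℝ) ^ 2 * (s ^ 7 / 28) + ρ) := by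
  set v : ℂ := δ * s with hv
  have hNe : (N : ℝ) = 1 / (8 * δ ^ 3) := by field_simp; linarith
  have hNc : (N : ℂ) = 1 / (8 * (δ : ℂ) ^ 3) := by
    have := congrArg (fun z : ℝ => (z : ℂ)) hNe
    push_cast at this
    exact this
  have hδc : (δ : ℂ) ≠ 0 := by exact_mod_cast hδ.ne'
  have h1 : 1 + v ≠ 0 := by
    intro h
    have : v = -1 := by linear_combination h
    rw [this] at hs
    norm_num at hs
  have h2 : 1 - v ≠ 0 := by
    intro h
    have : v = 1 := by linear_combination -h
    rw [this] at hs
    norm_num at hs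
  refine ⟨N * (Complex.log (1 + v) - Complex.log (1 - v)
      - (2 * v + 2 * v ^ 3 / 3 + 2 * v ^ 5 / 5 + 2 * v ^ 7 / 7)), ?_, ?_⟩
  · rw [norm_mul, Complex.norm_natCast]
    refine (mul_le_mul_of_nonneg_left (norm_log_one_add_sub_log_one_sub_le hs)
      (Nat.cast_nonneg N)).trans ?_
    rw [hv, norm_mul, Complex.norm_real, Real.norm_of_nonneg hδ.le, hNe]
    have h9 : 0 ≤ δ ^ 6 * ‖s‖ ^ 9 := by positivity
    calc 1 / (8 * δ ^ 3) * (δ * ‖s‖) ^ 9 = δ ^ 6 * ‖s‖ ^ 9 / 8 := by field_simp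
      _ ≤ δ ^ 6 * ‖s‖ ^ 9 := by linarith
      _ = _ := by ring
  · have hm : moebius v ^ N = Complex.exp (N * (Complex.log (1 + v) - Complex.log (1 - v))) := by
      rw [Complex.exp_nat_mul, Complex.exp_sub, Complex.exp_log h1, Complex.exp_log h2, moebius]
    rw [hm, ← Complex.exp_add, ← Complex.exp_add]
    congr 1
    rw [hNc, hv, softEdgeSq]
    push_cast
    field_simp
    ring

/-- Both exp w - (1 + w + w²/2) and the terms of order η³ hidden in w + w²/2 are controlled by the
single small quantity ηP. -/
lemma norm_exp_sub_quadratic_le {w A B ρ : ℂ} {η P : ℝ} (hη : 0 < η) (hP : 1 ≤ P)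
    (hηP : η * P ≤ 1) (hw : w = η * A + η ^ 2 * B + ρ) (hA : ‖A‖ ≤ P / 4) (hB : ‖B‖ ≤ P / 4)
    (hρ : ‖ρ‖ ≤ η ^ 3 * (P / 4)) :
    ‖Complex.exp w - (1 + η * A + η ^ 2 * (B + A ^ 2 / 2))‖ ≤ 5 * (η * P) ^ 3 := by
  have hη1 : η ≤ 1 := by nlinarith
  set X := η * P with hX
  have hX0 : 0 < X := by positivity
  have n1 : ‖(η : ℂ) * A‖ ≤ X / 4 := by
    rw [norm_mul, Complex.norm_real, Real.norm_of_nonneg hη.le]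
    nlinarith
  have n2 : ‖(η : ℂ) ^ 2 * B‖ ≤ η * (X / 4) := by
    rw [norm_mul, norm_pow, Complex.norm_real, Real.norm_of_nonneg hη.le]
    calc η ^ 2 * ‖B‖ ≤ η ^ 2 * (P / 4) := mul_le_mul_of_nonneg_left hB (by positivity)
      _ = _ := by rw [hX]; ring
  have n3 : ‖ρ‖ ≤ η ^ 2 * (X / 4) := hρ.trans (le_of_eq (by rw [hX]; ring))
  have hηX : η ≤ X := by nlinarith
  have n2' : ‖(η : ℂ) ^ 2 * B‖ ≤ X ^ 2 / 4 := n2.trans (by nlinarith)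
  have n3' : ‖ρ‖ ≤ X ^ 3 / 4 := n3.trans (by
    have : η ^ 2 ≤ X ^ 2 := pow_le_pow_left₀ hη.le hηX 2
    nlinarith)
  have hX2 : X ^ 2 ≤ X := by nlinarith
  have hX3 : X ^ 3 ≤ X ^ 2 := by nlinarith [sq_nonneg X]
  have nd : ‖w - η * A‖ ≤ X ^ 2 / 2 := by
    rw [hw, show (η : ℂ) * A + η ^ 2 * B + ρ - η * A = η ^ 2 * B + ρ by ring]
    exact (norm_add_le _ _).trans (by linarith)
  have nw : ‖w‖ ≤ X := by
    have : w = (w - η * A) + η * A := by ring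
    rw [this]
    exact (norm_add_le _ _).trans (by linarith)
  have ns : ‖w + η * A‖ ≤ 2 * X := (norm_add_le _ _).trans (by linarith)
  have hexp := Complex.norm_exp_sub_sum_le_norm_mul_exp w 3
  have he : Real.exp ‖w‖ ≤ 3 :=
    (Real.exp_le_exp.mpr (nw.trans hηP)).trans (by linarith [Real.exp_one_lt_d9])
  have hmain : ‖Complex.exp w - (1 + w + w ^ 2 / 2)‖ ≤ 3 * X ^ 3 := by
    have e : Complex.exp w - (1 + w + w ^ 2 / 2)
        = Complex.exp w - ∑ m ∈ Finset.range 3, w ^ m / (m.factorial : ℂ) := by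
      simp [Finset.sum_range_succ, Nat.factorial]
    rw [e]
    refine hexp.trans ?_
    rw [mul_comm 3]
    exact mul_le_mul (pow_le_pow_left₀ (norm_nonneg _) nw 3) he (Real.exp_pos _).le (by positivity)
  have e : Complex.exp w - (1 + η * A + η ^ 2 * (B + A ^ 2 / 2))
      = (Complex.exp w - (1 + w + w ^ 2 / 2)) + (ρ + (w - η * A) * (w + η * A) / 2) := by
    rw [hw]; ring
  rw [e]
  have hprod : ‖(w - η * A) * (w + η * A) / 2‖ ≤ X ^ 3 / 2 := by
    rw [norm_div, norm_mul, Complex.norm_ofNat]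
    have := mul_le_mul nd ns (norm_nonneg _) (by positivity)
    have e : X ^ 2 / 2 * (2 * X) = X ^ 3 := by ring
    linarith
  have := norm_add_le (Complex.exp w - (1 + w + w ^ 2 / 2)) (ρ + (w - η * A) * (w + η * A) / 2)
  have := norm_add_le ρ ((w - η * A) * (w + η * A) / 2)
  have : 0 < X ^ 3 := by positivity
  linarith

/-- The real part of (c + iτ)³/12 is c³/12 - cτ²/4. The rate is weakened to c/32 to match
`norm_exp_mul_moebius_pow_le`. -/
lemma norm_exp_cube_sub_le {c : ℝ} (hc : 0 < c) (y τ : ℝ) :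
    ‖Complex.exp (verticalLine c τ ^ 3 / 12 - y * verticalLine c τ)‖
      ≤ Real.exp (c ^ 3 / 12 - y * c) * Real.exp (-(c / 32 * τ ^ 2)) := by
  have e : (verticalLine c τ ^ 3 / 12 - y * verticalLine c τ).re
      = c ^ 3 / 12 - c / 4 * τ ^ 2 - y * c := by
    rw [Complex.sub_re, Complex.re_ofReal_mul, verticalLine_re]
    have h12 : (verticalLine c τ ^ 3 / 12).re = (verticalLine c τ ^ 3).re / 12 := by simp
    rw [h12, pow_succ, sq, Complex.mul_re, Complex.mul_re, Complex.mul_im]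
    simp only [verticalLine_re, verticalLine_im]
    ring
  rw [Complex.norm_exp, e, ← Real.exp_add]
  refine Real.exp_le_exp.mpr ?_
  nlinarith [mul_nonneg hc.le (sq_nonneg τ)]

/-- A polynomial bound for the coefficients `softEdgePoly`. -/
noncomputable def softEdgeBound (y : ℝ) (s : ℂ) : ℝ := 4 * (1 + y ^ 2) * (1 + ‖s‖) ^ 9

lemma one_le_softEdgeBound (y : ℝ) (s : ℂ) : 1 ≤ softEdgeBound y s := by
  have h1 : 1 ≤ (1 + ‖s‖) ^ 9 := one_le_pow₀ (by linarith [norm_nonneg s])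
  unfold softEdgeBound
  nlinarith [sq_nonneg y]

lemma norm_pow_le_one_add_norm_pow {s : ℂ} {k n : ℕ} (h : k ≤ n) : ‖s‖ ^ k ≤ (1 + ‖s‖) ^ n :=
  (pow_le_pow_left₀ (norm_nonneg s) (by linarith) k).trans
    (pow_le_pow_right₀ (by linarith [norm_nonneg s]) h)

lemma norm_softEdgePoly_one_le (y : ℝ) (s : ℂ) :
    ‖s ^ 5 / 20 - y ^ 2 * s‖ ≤ softEdgeBound y s / 4 := by
  have h5 : ‖s‖ ^ 5 ≤ (1 + ‖s‖) ^ 9 := norm_pow_le_one_add_norm_pow (by norm_num)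
  have h1 : ‖s‖ ≤ (1 + ‖s‖) ^ 9 := by
    simpa using norm_pow_le_one_add_norm_pow (s := s) (k := 1) (n := 9) (by norm_num)
  refine (norm_sub_le _ _).trans ?_
  rw [norm_div, norm_mul, norm_pow, norm_pow, Complex.norm_real, Real.norm_eq_abs, sq_abs,
    Complex.norm_ofNat, softEdgeBound]
  nlinarith [mul_le_mul_of_nonneg_left h1 (sq_nonneg y), pow_nonneg (norm_nonneg s) 5]

lemma norm_pow_seven_div_le (y : ℝ) (s : ℂ) : ‖s ^ 7 / 28‖ ≤ softEdgeBound y s / 4 := by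
  have h7 : ‖s‖ ^ 7 ≤ (1 + ‖s‖) ^ 9 := norm_pow_le_one_add_norm_pow (by norm_num)
  rw [norm_div, norm_pow, Complex.norm_ofNat, softEdgeBound]
  nlinarith [sq_nonneg y, pow_nonneg (norm_nonneg s) 7,
    mul_nonneg (sq_nonneg y) (pow_nonneg (add_nonneg zero_le_one (norm_nonneg s)) 9)]

lemma exp_neg_div_le {c δ : ℝ} (hc : 0 < c) (hδ : 0 < δ) :
    Real.exp (-(c / (32 * δ ^ 2))) ≤ 6 * (32 / c) ^ 3 * (δ ^ 2) ^ 3 := by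
  have h := Real.pow_div_factorial_le_exp (c / (32 * δ ^ 2)) (by positivity) 3
  rw [Real.exp_neg]
  have hpos : 0 < (c / (32 * δ ^ 2)) ^ 3 / (Nat.factorial 3 : ℝ) := by positivity
  refine (inv_anti₀ hpos h).trans (le_of_eq ?_)
  norm_num [Nat.factorial]
  field_simp

/-- Let Q be `softEdgeBound`. Where δ²Q ≤ 1 the Taylor expansion applies with error of order (δ²Q)³.
Where δ²Q > 1 that quantity exceeds 1, so bounding the two terms separately already suffices. The
exponentially small constant of the crude bound is absorbed into δ⁶, which accounts for the summand
1. -/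
lemma norm_contourIntegrand_sub_le {c y : ℝ} (hc : 0 < c) :
    ∃ K : ℝ, 0 ≤ K ∧ ∀ (δ : ℝ) (N : ℕ), 0 < δ → δ ≤ 1 → δ * c ≤ 1 / 2 →
      (N : ℝ) * (8 * δ ^ 3) = 1 → ∀ τ : ℝ,
      ‖Complex.exp (-(softEdgeSq δ y * (δ * verticalLine c τ)))
          * moebius (δ * verticalLine c τ) ^ N
        - Complex.exp (verticalLine c τ ^ 3 / 12 - y * verticalLine c τ)
          * ∑ i ∈ Finset.range 3, ((δ ^ 2 : ℝ) : ℂ) ^ i * softEdgePoly y (verticalLine c τ) i‖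
      ≤ (δ ^ 2) ^ 3 * (K *
        (softEdgeBound y (verticalLine c τ) ^ 3 * Real.exp (-(c / 32 * τ ^ 2)) + 1)) := by
  set C₀ := Real.exp (c ^ 3 / 12 - y * c) with hC₀
  set C₁ := Real.exp (c ^ 3 / 2 - y * c) with hC₁
  have hC₀p : 0 < C₀ := Real.exp_pos _
  have hC₁p : 0 < C₁ := Real.exp_pos _
  refine ⟨5 * C₀ + C₁ + C₁ * (6 * (32 / c) ^ 3), by positivity, ?_⟩
  intro δ N hδ hδ1 hδc hN τ
  set s := verticalLine c τ with hs
  set Q := softEdgeBound y s with hQ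
  set e₁ := Real.exp (-(c / 32 * τ ^ 2)) with he₁
  have he₁p : 0 < e₁ := Real.exp_pos _
  have hQ1 : 1 ≤ Q := one_le_softEdgeBound y s
  have hη : 0 < δ ^ 2 := by positivity
  have hη1 : δ ^ 2 ≤ 1 := pow_le_one₀ hδ.le hδ1
  have hE := norm_exp_cube_sub_le hc y τ
  rw [← hs, ← hC₀, ← he₁] at hE
  have hA := norm_softEdgePoly_one_le y s
  have hB := norm_pow_seven_div_le y s
  rw [← hQ] at hA hB
  have hsum : ∑ i ∈ Finset.range 3, ((δ ^ 2 : ℝ) : ℂ) ^ i * softEdgePoly y s i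
      = 1 + (δ ^ 2 : ℝ) * (s ^ 5 / 20 - y ^ 2 * s) + ((δ ^ 2 : ℝ) : ℂ) ^ 2 *
        (s ^ 7 / 28 + (s ^ 5 / 20 - y ^ 2 * s) ^ 2 / 2) := by
    simp [Finset.sum_range_succ, softEdgePoly]
  rw [hsum]
  set A := s ^ 5 / 20 - y ^ 2 * s with hA'
  set B := s ^ 7 / 28 with hB'
  have hX3 : (δ ^ 2 * Q) ^ 3 = (δ ^ 2) ^ 3 * Q ^ 3 := mul_pow _ _ _
  have hη3 : 0 < (δ ^ 2) ^ 3 := by positivity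
  rcases le_or_gt (δ ^ 2 * Q) 1 with hX | hX
  -- The factor 4 in `softEdgeBound` gives 4‖s‖² ≤ Q, so δ²Q ≤ 1 puts δs inside the disc where the
  -- logarithms are expanded.
  · have hsmall : ‖(δ : ℂ) * s‖ ≤ 1 / 2 := by
      have h2 : ‖s‖ ^ 2 ≤ (1 + ‖s‖) ^ 9 := norm_pow_le_one_add_norm_pow (by norm_num)
      have h4 : 4 * ‖s‖ ^ 2 ≤ Q := by
        rw [hQ, softEdgeBound]
        nlinarith [mul_nonneg (sq_nonneg y)
          (pow_nonneg (add_nonneg zero_le_one (norm_nonneg s)) 9)]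
      refine abs_le_of_sq_le_sq' ?_ (by norm_num) |>.2
      rw [norm_mul, Complex.norm_real, Real.norm_of_nonneg hδ.le, mul_pow]
      nlinarith
    obtain ⟨ρ, hρ, heq⟩ := exp_mul_moebius_pow_eq (y := y) hδ hN hsmall
    have hρ' : ‖ρ‖ ≤ (δ ^ 2) ^ 3 * (Q / 4) := by
      refine hρ.trans (mul_le_mul_of_nonneg_left ?_ hη3.le)
      have h9 : ‖s‖ ^ 9 ≤ (1 + ‖s‖) ^ 9 := norm_pow_le_one_add_norm_pow le_rfl
      rw [hQ, softEdgeBound]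
      nlinarith [mul_nonneg (sq_nonneg y)
          (pow_nonneg (add_nonneg zero_le_one (norm_nonneg s)) 9)]
    have hmain := norm_exp_sub_quadratic_le (w := (δ ^ 2 : ℝ) * A + ((δ ^ 2 : ℝ) : ℂ) ^ 2 * B + ρ)
      hη hQ1 hX rfl hA hB hρ'
    rw [heq, ← mul_sub, norm_mul]
    calc _ ≤ C₀ * e₁ * (5 * (δ ^ 2 * Q) ^ 3) :=
          mul_le_mul hE hmain (norm_nonneg _) (by positivity)
      _ = (δ ^ 2) ^ 3 * (5 * C₀ * (Q ^ 3 * e₁)) := by rw [hX3]; ring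
      _ ≤ _ := by
        refine mul_le_mul_of_nonneg_left ?_ hη3.le
        refine mul_le_mul ?_ (by linarith) (by positivity) (by positivity)
        have : 0 ≤ C₁ * (6 * (32 / c) ^ 3) := by positivity
        linarith
  · have hX1 : 1 ≤ (δ ^ 2 * Q) ^ 3 := one_le_pow₀ hX.le
    have h1 := norm_exp_mul_moebius_pow_le (y := y) hc hδ hN hδc τ
    rw [← hs, ← hC₁, ← he₁] at h1
    have h2 := exp_neg_div_le hc hδ
    have h3 : ‖1 + ((δ ^ 2 : ℝ) : ℂ) * A + ((δ ^ 2 : ℝ) : ℂ) ^ 2 * (B + A ^ 2 / 2)‖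
        ≤ 5 * (δ ^ 2 * Q) ^ 3 := by
      have n1 : ‖((δ ^ 2 : ℝ) : ℂ) * A‖ ≤ δ ^ 2 * Q := by
        rw [norm_mul, Complex.norm_real, Real.norm_of_nonneg hη.le]
        exact mul_le_mul_of_nonneg_left (by linarith) hη.le
      have n2 : ‖B + A ^ 2 / 2‖ ≤ Q ^ 2 := by
        refine (norm_add_le _ _).trans ?_
        rw [norm_div (A ^ 2), norm_pow A, Complex.norm_ofNat]
        have := pow_le_pow_left₀ (norm_nonneg A) hA 2
        nlinarith
      have n3 : ‖((δ ^ 2 : ℝ) : ℂ) ^ 2 * (B + A ^ 2 / 2)‖ ≤ (δ ^ 2 * Q) ^ 2 := by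
        rw [norm_mul, norm_pow, Complex.norm_real, Real.norm_of_nonneg hη.le, mul_pow]
        exact mul_le_mul_of_nonneg_left n2 (by positivity)
      have n4 := norm_add₃_le (a := (1 : ℂ)) (b := ((δ ^ 2 : ℝ) : ℂ) * A)
        (c := ((δ ^ 2 : ℝ) : ℂ) ^ 2 * (B + A ^ 2 / 2))
      rw [norm_one] at n4
      have hX2 : (δ ^ 2 * Q) ^ 2 ≤ (δ ^ 2 * Q) ^ 3 := pow_le_pow_right₀ hX.le (by norm_num)
      have hX0 : δ ^ 2 * Q ≤ (δ ^ 2 * Q) ^ 3 := le_self_pow₀ hX.le (by norm_num)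
      linarith
    refine (norm_sub_le _ _).trans ?_
    rw [norm_mul (Complex.exp (s ^ 3 / 12 - y * s))]
    calc _ ≤ C₁ * ((δ ^ 2 * Q) ^ 3 * e₁ + 6 * (32 / c) ^ 3 * (δ ^ 2) ^ 3)
          + C₀ * e₁ * (5 * (δ ^ 2 * Q) ^ 3) := by
          refine add_le_add (h1.trans (mul_le_mul_of_nonneg_left (add_le_add ?_ h2) hC₁p.le))
            (mul_le_mul hE h3 (norm_nonneg _) (by positivity))
          exact le_mul_of_one_le_left he₁p.le hX1
      _ = (δ ^ 2) ^ 3 * ((5 * C₀ + C₁) * (Q ^ 3 * e₁) + C₁ * (6 * (32 / c) ^ 3) * 1) := by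
          rw [hX3]; ring
      _ ≤ _ := by
        refine mul_le_mul_of_nonneg_left ?_ hη3.le
        have k1 : 0 ≤ C₁ * (6 * (32 / c) ^ 3) := by positivity
        have k2 : 0 ≤ Q ^ 3 * e₁ := by positivity
        nlinarith [mul_nonneg k1 k2]

/-! ### Integrability of the limiting integrands -/

lemma integrable_one_add_norm_pow_mul_exp {c b : ℝ} (hc : 0 < c) (hb : 0 < b) (n : ℕ) :
    Integrable fun τ : ℝ => (1 + ‖verticalLine c τ‖) ^ n * Real.exp (-(b * τ ^ 2)) := by
  have h := (integrable_exp_neg_mul_sq (half_pos hb)).const_mul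
    (n.factorial * Real.exp (1 + c + 1 / (2 * b)))
  refine h.mono' ?_ (Eventually.of_forall fun τ => ?_)
  · exact (((continuous_const.add (continuous_verticalLine c).norm).pow n).mul
      (by fun_prop)).aestronglyMeasurable
  · have h0 : 0 ≤ 1 + ‖verticalLine c τ‖ := by positivity
    rw [Real.norm_of_nonneg (by positivity)]
    have h1 := Real.pow_div_factorial_le_exp (1 + ‖verticalLine c τ‖) h0 n
    rw [div_le_iff₀ (by positivity)] at h1
    have h2 : ‖verticalLine c τ‖ ≤ c + |τ| := by
      refine (norm_add_le _ _).trans ?_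
      simp [abs_of_pos hc]
    -- Half of the Gaussian exponent absorbs the exponential that dominates the polynomial factor.
    have h3 : |τ| ≤ b / 2 * τ ^ 2 + 1 / (2 * b) := by
      rw [← sq_abs τ]
      have : b / 2 * |τ| ^ 2 + 1 / (2 * b) - |τ| = (b * |τ| - 1) ^ 2 / (2 * b) := by
        field_simp
        ring
      have : 0 ≤ (b * |τ| - 1) ^ 2 / (2 * b) := by positivity
      linarith
    calc (1 + ‖verticalLine c τ‖) ^ n * Real.exp (-(b * τ ^ 2))
        ≤ (Real.exp (1 + ‖verticalLine c τ‖) * n.factorial) * Real.exp (-(b * τ ^ 2)) :=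
          mul_le_mul_of_nonneg_right h1 (Real.exp_pos _).le
      _ = n.factorial * Real.exp (1 + ‖verticalLine c τ‖ - b * τ ^ 2) := by
          rw [sub_eq_add_neg, Real.exp_add _ (-(b * τ ^ 2))]; ring
      _ ≤ n.factorial * Real.exp (1 + c + 1 / (2 * b) + -(b / 2) * τ ^ 2) := by
          refine mul_le_mul_of_nonneg_left (Real.exp_le_exp.mpr ?_) (by positivity)
          linarith
      _ = _ := by rw [Real.exp_add]; ring

/-- The functions `s ^ (k - 7/2) * exp (s³/12 - y s)`. -/
noncomputable def airyKernel (k : ℕ) (y : ℝ) (s : ℂ) : ℂ :=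
  s ^ k * s ^ (-7 / 2 : ℂ) * Complex.exp (s ^ 3 / 12 - y * s)

lemma hasDerivAt_airyKernel_succ (k : ℕ) (y : ℝ) {s : ℂ} (hs : 0 < s.re) :
    HasDerivAt (airyKernel (k + 1) y)
      ((k - 5 / 2) * airyKernel k y s + airyKernel (k + 3) y s / 4 - y * airyKernel (k + 1) y s)
      s := by
  have h0 := ne_zero_of_re_pos hs
  have h1 := (hasDerivAt_id s).cpow_const (c := (-7 / 2 : ℂ)) (mem_slitPlane_of_re_pos hs)
  have h2 := (((hasDerivAt_pow 3 s).div_const 12).sub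
    ((hasDerivAt_id s).const_mul (y : ℂ))).cexp
  have h3 := hasDerivAt_pow (k + 1) s
  convert! (h3.mul h1).mul h2 using 1
  simp only [airyKernel, id, Pi.mul_apply, Pi.sub_apply]
  rw [Complex.cpow_sub _ _ h0, Complex.cpow_one]
  push_cast
  simp only [pow_succ]
  field_simp
  ring

lemma differentiableOn_airyKernel (k : ℕ) (y : ℝ) :
    DifferentiableOn ℂ (airyKernel k y) {s | 0 < s.re} := by
  intro s hs
  refine DifferentiableAt.differentiableWithinAt ?_
  have h1 := ((hasDerivAt_id s).cpow_const (c := (-7 / 2 : ℂ))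
    (mem_slitPlane_of_re_pos hs)).differentiableAt
  exact ((differentiableAt_id.pow k).mul h1).mul (by fun_prop)

lemma integrable_airyKernel (k : ℕ) (y : ℝ) {c : ℝ} (hc : 0 < c) :
    Integrable fun τ : ℝ => airyKernel k y (verticalLine c τ) := by
  refine ((integrable_one_add_norm_pow_mul_exp hc (b := c / 32) (by positivity) k).const_mul
    (c ^ (-7 / 2 : ℝ) * Real.exp (c ^ 3 / 12 - y * c))).mono'
    (continuous_comp_verticalLine (differentiableOn_airyKernel k y) hc).aestronglyMeasurable
    (Eventually.of_forall fun τ => ?_)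
  rw [airyKernel, norm_mul, norm_mul, norm_pow,
    norm_cpow_real_div _ (-7 / 2) (by push_cast; ring)]
  have h1 := norm_exp_cube_sub_le hc y τ
  have h2 : ‖verticalLine c τ‖ ^ (-7 / 2 : ℝ) ≤ c ^ (-7 / 2 : ℝ) :=
    Real.rpow_le_rpow_of_nonpos hc (le_norm_verticalLine c τ) (by norm_num)
  have h3 : ‖verticalLine c τ‖ ^ k ≤ (1 + ‖verticalLine c τ‖) ^ k :=
    norm_pow_le_one_add_norm_pow le_rfl
  calc _ ≤ (1 + ‖verticalLine c τ‖) ^ k * c ^ (-7 / 2 : ℝ) *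
        (Real.exp (c ^ 3 / 12 - y * c) * Real.exp (-(c / 32 * τ ^ 2))) := by gcongr
    _ = _ := by ring

/-- The integrand of the `i`-th coefficient of the soft edge expansion. -/
noncomputable def softEdgeTerm (y : ℝ) (i : ℕ) (s : ℂ) : ℂ :=
  s ^ (-3 / 2 : ℂ) * (Complex.exp (s ^ 3 / 12 - y * s) * softEdgePoly y s i)

lemma cpow_neg_three_halves {s : ℂ} (hs : s ≠ 0) :
    s ^ (-3 / 2 : ℂ) = s ^ 2 * s ^ (-7 / 2 : ℂ) := by
  rw [show (-3 / 2 : ℂ) = (2 : ℕ) + -7 / 2 by norm_num, Complex.cpow_add _ _ hs,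
    Complex.cpow_natCast]

lemma softEdgeTerm_zero (y : ℝ) {s : ℂ} (hs : s ≠ 0) :
    softEdgeTerm y 0 s = airyKernel 2 y s := by
  rw [softEdgeTerm, cpow_neg_three_halves hs, softEdgePoly, airyKernel]
  ring

lemma softEdgeTerm_one (y : ℝ) {s : ℂ} (hs : s ≠ 0) :
    softEdgeTerm y 1 s = 1 / 20 * airyKernel 7 y s - y ^ 2 * airyKernel 3 y s := by
  rw [softEdgeTerm, cpow_neg_three_halves hs, softEdgePoly, airyKernel, airyKernel]
  ring

lemma softEdgeTerm_two (y : ℝ) {s : ℂ} (hs : s ≠ 0) :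
    softEdgeTerm y 2 s = 1 / 28 * airyKernel 9 y s + 1 / 800 * airyKernel 12 y s
      - y ^ 2 / 20 * airyKernel 8 y s + y ^ 4 / 2 * airyKernel 4 y s := by
  rw [softEdgeTerm, cpow_neg_three_halves hs, softEdgePoly, airyKernel, airyKernel, airyKernel,
    airyKernel]
  ring

lemma verticalLine_ne_zero {c : ℝ} (hc : 0 < c) (τ : ℝ) : verticalLine c τ ≠ 0 :=
  ne_zero_of_re_pos (by simpa using hc)

lemma integrable_softEdgeTerm (y : ℝ) (i : ℕ) {c : ℝ} (hc : 0 < c) :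
    Integrable fun τ : ℝ => softEdgeTerm y i (verticalLine c τ) := by
  have hi := fun k => integrable_airyKernel k y hc
  match i with
  | 0 => simpa only [softEdgeTerm_zero y (verticalLine_ne_zero hc _)] using hi 2
  | 1 =>
    simp only [softEdgeTerm_one y (verticalLine_ne_zero hc _)]
    exact ((hi 7).const_mul _).sub ((hi 3).const_mul _)
  | 2 =>
    simp only [softEdgeTerm_two y (verticalLine_ne_zero hc _)]
    exact ((((hi 9).const_mul _).add ((hi 12).const_mul _)).sub ((hi 8).const_mul _)).add
      ((hi 4).const_mul _)
  | n + 3 => simp [softEdgeTerm, softEdgePoly]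

/-! ### The soft edge expansion -/

lemma ofReal_mul_cpow {r : ℝ} (hr : 0 < r) {s : ℂ} (hs : s ≠ 0) (p : ℂ) :
    ((r : ℂ) * s) ^ p = (r : ℂ) ^ p * s ^ p := by
  have hr' : (r : ℂ) ≠ 0 := by exact_mod_cast hr.ne'
  rw [Complex.cpow_def_of_ne_zero (mul_ne_zero hr' hs), Complex.cpow_def_of_ne_zero hr',
    Complex.cpow_def_of_ne_zero hs, Complex.log_ofReal_mul hr hs, Complex.ofReal_log hr.le,
    add_mul, Complex.exp_add]

lemma inv_sq_cpow_neg_three_halves {m : ℝ} (hm : 0 < m) :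
    ((((m ^ 2)⁻¹ : ℝ) : ℂ)) ^ (-3 / 2 : ℂ) = ((m ^ 3 : ℝ) : ℂ) := by
  rw [show (-3 / 2 : ℂ) = ((-3 / 2 : ℝ) : ℂ) by push_cast; ring,
    ← Complex.ofReal_cpow (by positivity)]
  congr 1
  rw [Real.inv_rpow (by positivity), ← Real.rpow_natCast, ← Real.rpow_mul hm.le, ← Real.rpow_neg
    hm.le, ← Real.rpow_natCast]
  norm_num

/-- The contour integrand of the density in soft edge variables. -/
noncomputable def softEdgeIntegrand (δ y : ℝ) (N : ℕ) (s : ℂ) : ℂ :=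
  s ^ (-3 / 2 : ℂ) * (Complex.exp (-(softEdgeSq δ y * (δ * s))) * moebius (δ * s) ^ N)

lemma contourKernel_mul_moebius_eq {m c : ℝ} (hm : 0 < m) (hc : 0 < c) (y : ℝ) (N : ℕ) (τ : ℝ) :
    contourKernel (softEdgeSq (m ^ 2)⁻¹ y) (verticalLine ((m ^ 2)⁻¹ * c) ((m ^ 2)⁻¹ * τ))
        * moebius (verticalLine ((m ^ 2)⁻¹ * c) ((m ^ 2)⁻¹ * τ)) ^ N
      = ((m ^ 3 : ℝ) : ℂ) * softEdgeIntegrand (m ^ 2)⁻¹ y N (verticalLine c τ) := by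
  rw [← ofReal_mul_verticalLine, contourKernel,
    ofReal_mul_cpow (by positivity) (verticalLine_ne_zero hc τ),
    inv_sq_cpow_neg_three_halves hm, softEdgeIntegrand]
  ring

lemma softEdgeSq_inv_sq {m : ℝ} (hm : 0 < m) (y : ℝ) :
    softEdgeSq (m ^ 2)⁻¹ y = (m ^ 3 / 2 + y / m) ^ 2 := by
  rw [softEdgeSq]
  field_simp
  ring

lemma integrable_softEdgeIntegrand {m c : ℝ} (hm : 0 < m) (hc : 0 < c)
    (hmc : (m ^ 2)⁻¹ * c ≤ 1 / 2) (y : ℝ) (N : ℕ) :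
    Integrable fun τ : ℝ => softEdgeIntegrand (m ^ 2)⁻¹ y N (verticalLine c τ) := by
  have hX : 0 ≤ softEdgeSq (m ^ 2)⁻¹ y := by rw [softEdgeSq_inv_sq hm]; positivity
  have h := (integrable_contourKernel_mul_moebius hX (a := (m ^ 2)⁻¹ * c) (by positivity)
    (by linarith) N).comp_mul_left' (R := (m ^ 2)⁻¹) (by positivity)
  simp only [zpow_natCast, contourKernel_mul_moebius_eq hm hc] at h
  have hm3 : ((m ^ 3 : ℝ) : ℂ) ≠ 0 := by exact_mod_cast (pow_pos hm 3).ne'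
  exact (h.const_mul (((m ^ 3 : ℝ) : ℂ)⁻¹)).congr
    (Eventually.of_forall fun τ => inv_mul_cancel_left₀ hm3 _)

lemma gueDensity_eq_integral_softEdgeIntegrand {m c : ℝ} (hm : 0 < m) (hc : 0 < c)
    (hmc : (m ^ 2)⁻¹ * c ≤ 1 / 2) (y : ℝ) (N : ℕ) :
    4 * Real.pi * √Real.pi * ((1 / m * gueDensity N (m ^ 3 / 2 + y / m) : ℝ) : ℂ)
      = ∫ τ : ℝ, softEdgeIntegrand (m ^ 2)⁻¹ y N (verticalLine c τ) := by
  have h := gueDensity_eq_integral (a := (m ^ 2)⁻¹ * c) (by positivity) (by linarith) N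
    (m ^ 3 / 2 + y / m)
  rw [← softEdgeSq_inv_sq hm] at h
  have hsub := Measure.integral_comp_mul_left (fun t : ℝ =>
    contourKernel (softEdgeSq (m ^ 2)⁻¹ y) (verticalLine ((m ^ 2)⁻¹ * c) t)
      * moebius (verticalLine ((m ^ 2)⁻¹ * c) t) ^ N) (m ^ 2)⁻¹
  simp only [contourKernel_mul_moebius_eq hm hc] at hsub
  rw [integral_const_mul, ← h, inv_inv, abs_of_pos (by positivity : 0 < m ^ 2),
    Complex.real_smul] at hsub
  have hmC : (m : ℂ) ≠ 0 := Complex.ofReal_ne_zero.mpr hm.ne'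
  push_cast at hsub ⊢
  refine mul_left_cancel₀ (pow_ne_zero 3 hmC) ?_
  rw [hsub]
  field_simp

/-- The summand 1 has no Gaussian decay; the factor ‖s‖^(-3/2) makes it integrable. -/
lemma integrable_softEdgeBound_cube_mul {c : ℝ} (hc : 0 < c) (y : ℝ) : Integrable fun τ : ℝ =>
    ‖verticalLine c τ‖ ^ (-3 / 2 : ℝ) *
      (softEdgeBound y (verticalLine c τ) ^ 3 * Real.exp (-(c / 32 * τ ^ 2)) + 1) := by
  have h1 := (integrable_one_add_norm_pow_mul_exp hc (b := c / 32) (by positivity) 27).const_mul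
    ((4 * (1 + y ^ 2)) ^ 3)
  have h2 : Integrable fun τ : ℝ => ‖verticalLine c τ‖ ^ (-3 / 2 : ℝ) *
      (softEdgeBound y (verticalLine c τ) ^ 3 * Real.exp (-(c / 32 * τ ^ 2))) := by
    refine (h1.const_mul (c ^ (-3 / 2 : ℝ))).mono' ?_ (Eventually.of_forall fun τ => ?_)
    · refine AEStronglyMeasurable.mul (integrable_norm_verticalLine_rpow hc).1 ?_
      have := (continuous_verticalLine c).norm
      unfold softEdgeBound
      exact Continuous.aestronglyMeasurable (by fun_prop)
    · have hb := (zero_le_one.trans (one_le_softEdgeBound y (verticalLine c τ)))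
      rw [Real.norm_of_nonneg (by positivity)]
      refine mul_le_mul (Real.rpow_le_rpow_of_nonpos hc (le_norm_verticalLine c τ) (by norm_num))
        (le_of_eq ?_) (by positivity) (by positivity)
      rw [softEdgeBound]
      ring
  simpa only [mul_add, mul_one] using! h2.add (integrable_norm_verticalLine_rpow hc)

lemma norm_integral_softEdgeIntegrand_sub_le {c : ℝ} (hc : 0 < c) (y : ℝ) :
    ∃ K : ℝ, ∀ (m : ℝ) (N : ℕ), 1 ≤ m → (m ^ 2)⁻¹ * c ≤ 1 / 2 → m ^ 6 = 8 * N →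
      ‖(∫ τ : ℝ, softEdgeIntegrand (m ^ 2)⁻¹ y N (verticalLine c τ)) -
        ∑ i ∈ Finset.range 3, ((((m ^ 2)⁻¹ ^ 2 : ℝ) : ℂ)) ^ i *
          ∫ τ : ℝ, softEdgeTerm y i (verticalLine c τ)‖ ≤ K * (((m ^ 2)⁻¹ ^ 2)) ^ 3 := by
  obtain ⟨K, hK, hbound⟩ := norm_contourIntegrand_sub_le (y := y) hc
  have hg := integrable_softEdgeBound_cube_mul hc y
  refine ⟨K * ∫ τ : ℝ, ‖verticalLine c τ‖ ^ (-3 / 2 : ℝ) *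
      (softEdgeBound y (verticalLine c τ) ^ 3 * Real.exp (-(c / 32 * τ ^ 2)) + 1), ?_⟩
  intro m N hm1 hmc hmN
  have hm : 0 < m := by linarith
  set δ := (m ^ 2)⁻¹ with hδ
  have hδ0 : 0 < δ := by positivity
  have hδ1 : δ ≤ 1 := inv_le_one_of_one_le₀ (one_le_pow₀ hm1)
  have hN : (N : ℝ) * (8 * δ ^ 3) = 1 := by
    have : (N : ℝ) = m ^ 6 / 8 := by linarith
    rw [this, hδ]
    field_simp
  have hi1 : Integrable fun τ : ℝ => softEdgeIntegrand δ y N (verticalLine c τ) :=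
    integrable_softEdgeIntegrand hm hc hmc y N
  have hi2 := fun i : ℕ => (integrable_softEdgeTerm y i hc).const_mul (((δ ^ 2 : ℝ) : ℂ) ^ i)
  have e : ∑ i ∈ Finset.range 3, ((δ ^ 2 : ℝ) : ℂ) ^ i *
      ∫ τ : ℝ, softEdgeTerm y i (verticalLine c τ) = ∫ τ : ℝ, ∑ i ∈ Finset.range 3,
        ((δ ^ 2 : ℝ) : ℂ) ^ i * softEdgeTerm y i (verticalLine c τ) := by
    rw [integral_finsetSum _ fun i _ => hi2 i]
    simp only [integral_const_mul]
  rw [e, ← integral_sub hi1 (integrable_finsetSum _ fun i _ => hi2 i)]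
  refine (norm_integral_le_of_norm_le (hg.const_mul ((δ ^ 2) ^ 3 * K))
    (Eventually.of_forall fun τ => ?_)).trans (le_of_eq ?_)
  · have h := hbound δ N hδ0 hδ1 hmc hN τ
    have e2 : softEdgeIntegrand δ y N (verticalLine c τ) - ∑ i ∈ Finset.range 3,
        ((δ ^ 2 : ℝ) : ℂ) ^ i * softEdgeTerm y i (verticalLine c τ)
        = verticalLine c τ ^ (-3 / 2 : ℂ) *
          (Complex.exp (-(softEdgeSq δ y * (δ * verticalLine c τ)))
            * moebius (δ * verticalLine c τ) ^ N
          - Complex.exp (verticalLine c τ ^ 3 / 12 - y * verticalLine c τ)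
            * ∑ i ∈ Finset.range 3, ((δ ^ 2 : ℝ) : ℂ) ^ i * softEdgePoly y (verticalLine c τ) i) := by
      simp only [softEdgeIntegrand, softEdgeTerm, Finset.sum_range_succ, Finset.sum_range_zero]
      ring
    rw [e2, norm_mul, norm_cpow_real_div _ (-3 / 2) (by push_cast; ring)]
    calc _ ≤ ‖verticalLine c τ‖ ^ (-3 / 2 : ℝ) * _ :=
          mul_le_mul_of_nonneg_left h (by positivity)
      _ = _ := by ring
  · rw [integral_const_mul]
    ring

/-- The coefficients of the soft edge expansion, as integrals along the line `re s = c`. -/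
noncomputable def softEdgeCoeff (c y : ℝ) (i : ℕ) : ℂ :=
  (4 * Real.pi * √Real.pi : ℂ)⁻¹ * ∫ τ : ℝ, softEdgeTerm y i (verticalLine c τ)

/-- The expansion parameter `4⁻¹ N ^ (-2/3)`. -/
noncomputable def softEdgeParam (N : ℕ) : ℝ := 4⁻¹ * (N : ℝ) ^ (-(2 / 3) : ℝ)

lemma tendsto_softEdgeParam : Tendsto softEdgeParam atTop (nhds 0) := by
  have := ((tendsto_rpow_neg_atTop (y := 2 / 3) (by norm_num)).comp
    tendsto_natCast_atTop_atTop).const_mul (4⁻¹ : ℝ)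
  simpa [Function.comp_def] using! this

lemma softEdgeParam_pos {N : ℕ} (hN : 0 < N) : 0 < softEdgeParam N := by
  unfold softEdgeParam; positivity

lemma softEdgeParam_pow (N i : ℕ) :
    softEdgeParam N ^ i = ((4 : ℝ) ^ i)⁻¹ * (N : ℝ) ^ (-(2 * i / 3 : ℝ)) := by
  rw [softEdgeParam, mul_pow, inv_pow, ← Real.rpow_natCast ((N : ℝ) ^ _),
    ← Real.rpow_mul (Nat.cast_nonneg N)]
  congr 2
  ring

theorem gueSoftEdgeDensity_sub_isLittleO {c : ℝ} (hc : 0 < c) (y : ℝ) :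
    (fun N : ℕ => (gueSoftEdgeDensity N y : ℂ) -
      ∑ i ∈ Finset.range 3, (softEdgeParam N : ℂ) ^ i * softEdgeCoeff c y i)
    =o[atTop] fun N : ℕ => softEdgeParam N ^ 2 := by
  obtain ⟨K, hK⟩ := norm_integral_softEdgeIntegrand_sub_le hc y
  have hpi : (4 * Real.pi * √Real.pi : ℂ) ≠ 0 := by
    have : (4 * Real.pi * √Real.pi : ℝ) ≠ 0 := by positivity
    exact_mod_cast this
  have hO : (fun N : ℕ => (gueSoftEdgeDensity N y : ℂ) -
      ∑ i ∈ Finset.range 3, (softEdgeParam N : ℂ) ^ i * softEdgeCoeff c y i)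
      =O[atTop] fun N : ℕ => softEdgeParam N ^ 3 := by
    refine IsBigO.of_bound (‖(4 * Real.pi * √Real.pi : ℂ)⁻¹‖ * K) ?_
    have hsmall : ∀ᶠ N : ℕ in atTop, softEdgeParam N * (4 * c ^ 2) < 1 := by
      have := tendsto_softEdgeParam.mul_const (4 * c ^ 2)
      rw [zero_mul] at this
      exact this.eventually_lt_const one_pos
    filter_upwards [hsmall, eventually_ge_atTop 1] with N hN hN1
    have hN0 : (0 : ℝ) < N := by exact_mod_cast hN1
    set q : ℝ := (N : ℝ) ^ (1 / 6 : ℝ) with hq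
    have hq0 : 0 < q := by positivity
    have hq1 : 1 ≤ q := Real.one_le_rpow (by exact_mod_cast hN1) (by norm_num)
    have hq6 : q ^ 6 = N := by
      rw [hq, ← Real.rpow_natCast, ← Real.rpow_mul hN0.le]
      norm_num
    have h2 : (√2 : ℝ) ^ 2 = 2 := Real.sq_sqrt (by norm_num)
    -- With this m the edge variable is m³/2 + y/m and m⁶ = 8N, so all fractional powers of N become
    -- integer powers of m.
    set m : ℝ := √2 * q with hm
    have hm1 : 1 ≤ m := by
      have : (1 : ℝ) ≤ √2 := Real.one_le_sqrt.mpr (by norm_num)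
      rw [hm]
      nlinarith
    have hm0 : 0 < m := by linarith
    have hm6 : m ^ 6 = 8 * N := by
      rw [hm, mul_pow, hq6, show (√2 : ℝ) ^ 6 = (√2 ^ 2) ^ 3 by ring, h2]
      norm_num
    have hη : (m ^ 2)⁻¹ ^ 2 = softEdgeParam N := by
      have e : (N : ℝ) ^ (-(2 / 3) : ℝ) = (q ^ 4)⁻¹ := by
        rw [hq, ← Real.rpow_natCast, ← Real.rpow_mul hN0.le, ← Real.rpow_neg hN0.le]
        norm_num
      rw [softEdgeParam, e, hm, mul_pow, h2]
      field_simp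
      norm_num
    have hmc : (m ^ 2)⁻¹ * c ≤ 1 / 2 := by
      refine abs_le_of_sq_le_sq' ?_ (by norm_num) |>.2
      rw [mul_pow, hη]
      linarith
    have hsqrt : √(2 * (N : ℝ)) = m ^ 3 / 2 := by
      rw [show 2 * (N : ℝ) = (m ^ 3 / 2) ^ 2 by
        have : (m ^ 3 / 2) ^ 2 = m ^ 6 / 4 := by ring
        rw [this, hm6]; ring]
      exact Real.sqrt_sq (by positivity)
    have hρ : gueSoftEdgeDensity N y = 1 / m * gueDensity N (m ^ 3 / 2 + y / m) := by
      rw [gueSoftEdgeDensity, hsqrt]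
    have hint := gueDensity_eq_integral_softEdgeIntegrand hm0 hc hmc y N
    rw [← hρ] at hint
    have hb := hK m N hm1 hmc hm6
    rw [hη, ← hint] at hb
    have e : (gueSoftEdgeDensity N y : ℂ) -
        ∑ i ∈ Finset.range 3, (softEdgeParam N : ℂ) ^ i * softEdgeCoeff c y i
        = (4 * Real.pi * √Real.pi : ℂ)⁻¹ * (4 * Real.pi * √Real.pi * (gueSoftEdgeDensity N y : ℂ) -
          ∑ i ∈ Finset.range 3, (softEdgeParam N : ℂ) ^ i *
            ∫ τ : ℝ, softEdgeTerm y i (verticalLine c τ)) := by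
      rw [mul_sub, inv_mul_cancel_left₀ hpi, Finset.mul_sum]
      congr 1
      refine Finset.sum_congr rfl fun i _ => ?_
      rw [softEdgeCoeff]
      ring
    rw [e, norm_mul, mul_assoc _ K, Real.norm_of_nonneg (pow_nonneg (softEdgeParam_pos hN1).le 3)]
    exact mul_le_mul_of_nonneg_left hb (norm_nonneg _)
  refine hO.trans_isLittleO ?_
  have h : (fun N => softEdgeParam N * softEdgeParam N ^ 2) =o[atTop]
      fun N => (1 : ℝ) * softEdgeParam N ^ 2 :=
    IsLittleO.mul_isBigO ((isLittleO_one_iff ℝ).mpr tendsto_softEdgeParam)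
      (isBigO_refl (fun N : ℕ => softEdgeParam N ^ 2) atTop)
  simpa only [one_mul, ← pow_succ'] using h

/-- Uniqueness of the coefficients of a second order asymptotic expansion. -/
lemma eq_zero_of_sum_pow_isLittleO {η : ℕ → ℝ} (h0 : Tendsto η atTop (nhds 0))
    (hpos : ∀ᶠ N in atTop, 0 < η N) {d : ℕ → ℂ}
    (h : (fun N => ∑ i ∈ Finset.range 3, (η N : ℂ) ^ i * d i) =o[atTop] fun N => η N ^ 2) :
    ∀ i ∈ Finset.range 3, d i = 0 := by
  have hc : Tendsto (fun N => (η N : ℂ)) atTop (nhds 0) := by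
    simpa using! (Complex.continuous_ofReal.tendsto 0).comp h0
  have hne : ∀ᶠ N in atTop, (η N : ℂ) ≠ 0 := by
    filter_upwards [hpos] with N hN
    exact_mod_cast hN.ne'
  have hη2 : Tendsto (fun N => (∑ i ∈ Finset.range 3, (η N : ℂ) ^ i * d i) / (η N : ℂ) ^ 2) atTop
      (nhds 0) := by
    have : (fun N => ∑ i ∈ Finset.range 3, (η N : ℂ) ^ i * d i) =o[atTop]
        fun N => (η N : ℂ) ^ 2 := by
      refine h.trans_isBigO (IsBigO.of_bound 1 (Eventually.of_forall fun N => ?_))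
      simp
    exact this.tendsto_div_nhds_zero
  simp only [Finset.sum_range_succ, Finset.sum_range_zero, zero_add, pow_zero, one_mul,
    pow_one] at hη2
  have hd0 : d 0 = 0 := by
    have h1 := hη2.mul (hc.pow 2)
    have h2 : Tendsto (fun N => d 0 + η N * d 1 + (η N : ℂ) ^ 2 * d 2) atTop (nhds (d 0)) := by
      simpa using ((hc.mul_const (d 1)).const_add (d 0)).add ((hc.pow 2).mul_const (d 2))
    refine tendsto_nhds_unique h2 ?_
    rw [zero_mul] at h1
    refine h1.congr' ?_
    filter_upwards [hne] with N hN
    field_simp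
  have hd1 : d 1 = 0 := by
    have h1 := hη2.mul hc
    have h2 : Tendsto (fun N => d 1 + η N * d 2) atTop (nhds (d 1)) := by
      simpa using (hc.mul_const (d 2)).const_add (d 1)
    refine tendsto_nhds_unique h2 ?_
    rw [zero_mul] at h1
    refine h1.congr' ?_
    filter_upwards [hne] with N hN
    rw [hd0]
    field_simp
    ring
  have hd2 : d 2 = 0 := by
    refine tendsto_nhds_unique tendsto_const_nhds (hη2.congr' ?_)
    filter_upwards [hne] with N hN
    rw [hd0, hd1]
    field_simp
    ring
  intro i hi
  have : i < 3 := Finset.mem_range.mp hi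
  interval_cases i <;> assumption

lemma isGUESoftEdgeExpansion_two_iff (r : ℕ → ℝ → ℝ) :
    IsGUESoftEdgeExpansion 2 r ↔ ∀ y : ℝ, (fun N : ℕ => gueSoftEdgeDensity N y -
      ∑ i ∈ Finset.range 3, softEdgeParam N ^ i * r i y) =o[atTop]
        fun N : ℕ => softEdgeParam N ^ 2 := by
  refine forall_congr' fun y => ?_
  simp only [softEdgeParam_pow]
  exact (isLittleO_const_mul_right_iff (by norm_num)).symm

/-- The coefficients of any soft edge expansion are given by the integrals along any vertical line
in the right half plane. -/
theorem IsGUESoftEdgeExpansion.eq_softEdgeCoeff {r : ℕ → ℝ → ℝ}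
    (hr : IsGUESoftEdgeExpansion 2 r) {c : ℝ} (hc : 0 < c) (y : ℝ) {i : ℕ} (hi : i ≤ 2) :
    (r i y : ℂ) = softEdgeCoeff c y i := by
  have h1 := (isGUESoftEdgeExpansion_two_iff r).mp hr y
  have h1' : (fun N : ℕ => (gueSoftEdgeDensity N y : ℂ) -
      ∑ i ∈ Finset.range 3, (softEdgeParam N : ℂ) ^ i * (r i y : ℂ)) =o[atTop]
        fun N : ℕ => softEdgeParam N ^ 2 := by
    refine IsBigO.trans_isLittleO (IsBigO.of_bound 1 (Eventually.of_forall fun N => ?_)) h1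
    rw [one_mul, ← Complex.norm_real]
    push_cast
    exact le_rfl
  -- Nothing in r depends on c, so the comparison below also shows that the line integrals do not.
  have h2 := (gueSoftEdgeDensity_sub_isLittleO hc y).sub h1'
  have hd := eq_zero_of_sum_pow_isLittleO tendsto_softEdgeParam
    ((eventually_gt_atTop 0).mono fun N hN => softEdgeParam_pos hN)
    (d := fun i => (r i y : ℂ) - softEdgeCoeff c y i) (h2.congr_left fun N => by
      simp only [mul_sub, Finset.sum_sub_distrib]
      ring)
  exact sub_eq_zero.mp (hd i (Finset.mem_range.mpr (by omega)))

/-- The density is real, so taking real parts of the complex expansion preserves the error bound;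
the integrals need not be shown real. The abscissa 1 is arbitrary. -/
theorem exists_isGUESoftEdgeExpansion : ∃ r : ℕ → ℝ → ℝ, IsGUESoftEdgeExpansion 2 r := by
  refine ⟨fun i y => (softEdgeCoeff 1 y i).re, (isGUESoftEdgeExpansion_two_iff _).mpr fun y => ?_⟩
  refine IsBigO.trans_isLittleO (IsBigO.of_bound 1 (Eventually.of_forall fun N => ?_))
    (gueSoftEdgeDensity_sub_isLittleO one_pos y)
  rw [one_mul, Real.norm_eq_abs]
  refine le_trans (le_of_eq ?_) (Complex.abs_re_le_norm _)
  congr 1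
  simp only [Complex.sub_re, Complex.ofReal_re, Complex.re_sum, ← Complex.ofReal_pow,
    Complex.re_ofReal_mul]

/-! ### Inversion of the bilateral Laplace transform -/

lemma integrable_exp_neg_mul_abs {κ : ℝ} (hκ : 0 < κ) :
    Integrable fun y : ℝ => Real.exp (-(κ * |y|)) := by
  rw [← integrableOn_univ, ← Set.Iic_union_Ioi (a := (0 : ℝ)), integrableOn_union]
  constructor
  · refine (integrableOn_exp_mul_Iic hκ 0).congr_fun (fun y hy => ?_) measurableSet_Iic
    simp only [abs_of_nonpos (Set.mem_Iic.mp hy)]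
    congr 1; ring
  · refine (integrableOn_exp_mul_Ioi (neg_lt_zero.mpr hκ) 0).congr_fun (fun y hy => ?_)
      measurableSet_Ioi
    simp only [abs_of_pos (Set.mem_Ioi.mp hy)]
    congr 1; ring

open FourierTransform in
/-- If `f` is given by the Laplace inversion integral of a holomorphic function `u` along every
vertical line of the right half plane, then `u` is the bilateral Laplace transform of `f`. -/
theorem integrable_and_integral_exp_mul_eq {f : ℝ → ℂ} {u : ℂ → ℂ}
    (hu : DifferentiableOn ℂ u {s | 0 < s.re})
    (hint : ∀ c : ℝ, 0 < c → Integrable fun τ : ℝ => u (verticalLine c τ))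
    (hf : ∀ c : ℝ, 0 < c → ∀ y : ℝ, f y = (2 * Real.pi : ℂ)⁻¹ *
      ∫ τ : ℝ, u (verticalLine c τ) * Complex.exp (-(y * verticalLine c τ)))
    {γ : ℂ} (hγ : 0 < γ.re) :
    Integrable (fun y : ℝ => Complex.exp (γ * y) * f y) ∧
      ∫ y : ℝ, Complex.exp (γ * y) * f y = u γ := by
  have hpi := Real.pi_pos
  have hpiC : (Real.pi : ℂ) ≠ 0 := by exact_mod_cast hpi.ne'
  set c := γ.re with hc
  set g : ℝ → ℂ := fun τ => u (verticalLine c τ) with hg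
  have hgc : Continuous g := continuous_comp_verticalLine hu hγ
  have hgi : Integrable g := hint c hγ
  -- The inversion integral along re s = re γ is a Fourier transform, with exp(cy) as the tilt.
  have hfourier : ∀ y : ℝ, 𝓕 g (y / (2 * Real.pi))
      = 2 * Real.pi * (Complex.exp (c * y) * f y) := by
    intro y
    rw [hf c hγ y, Real.fourier_real_eq_integral_exp_smul, ← mul_assoc, ← integral_const_mul,
      ← integral_const_mul]
    refine integral_congr_ae (Eventually.of_forall fun τ => ?_)
    have e : Complex.exp ((((-2 * Real.pi * τ * (y / (2 * Real.pi)) : ℝ)) : ℂ) * Complex.I)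
        = Complex.exp (c * y) * Complex.exp (-(y * verticalLine c τ)) := by
      rw [← Complex.exp_add]
      congr 1
      simp only [verticalLine]
      push_cast
      field_simp
      ring
    simp only [smul_eq_mul, e, hg]
    field_simp
  have hbound : ∃ M : ℝ, ∀ y : ℝ, ‖Complex.exp (c * y) * f y‖ ≤ M * Real.exp (-(c / 2 * |y|)) := by
    have hb : ∀ a : ℝ, 0 < a → ∃ M : ℝ, 0 ≤ M ∧ ∀ y : ℝ, ‖f y‖ ≤ M * Real.exp (-(a * y)) := by
      intro a ha
      refine ⟨‖(2 * Real.pi : ℂ)⁻¹‖ * ∫ τ : ℝ, ‖u (verticalLine a τ)‖, by positivity, fun y => ?_⟩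
      rw [hf a ha y, norm_mul, mul_assoc]
      refine mul_le_mul_of_nonneg_left ((norm_integral_le_integral_norm _).trans (le_of_eq ?_))
        (norm_nonneg _)
      rw [← integral_mul_const]
      refine integral_congr_ae (Eventually.of_forall fun τ => ?_)
      simp only [norm_mul, Complex.norm_exp, Complex.neg_re, Complex.re_ofReal_mul,
        verticalLine_re, mul_comm a y]
    -- Lines on either side of c give decay of exp(cy) f(y) at both ends: abscissa c/2 for y → -∞,
    -- 3c/2 for y → +∞.
    obtain ⟨M₁, h₁, hM₁⟩ := hb (c / 2) (by positivity)
    obtain ⟨M₂, h₂, hM₂⟩ := hb (3 * c / 2) (by positivity)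
    refine ⟨M₁ + M₂, fun y => ?_⟩
    rw [norm_mul, Complex.norm_exp, ← Complex.ofReal_mul, Complex.ofReal_re]
    rcases le_total 0 y with hy | hy
    · rw [abs_of_nonneg hy]
      calc _ ≤ Real.exp (c * y) * (M₂ * Real.exp (-(3 * c / 2 * y))) :=
            mul_le_mul_of_nonneg_left (hM₂ y) (Real.exp_pos _).le
        _ = M₂ * Real.exp (-(c / 2 * y)) := by
            rw [mul_left_comm, ← Real.exp_add]; congr 2; ring
        _ ≤ _ := mul_le_mul_of_nonneg_right (by linarith) (Real.exp_pos _).le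
    · rw [abs_of_nonpos hy]
      calc _ ≤ Real.exp (c * y) * (M₁ * Real.exp (-(c / 2 * y))) :=
            mul_le_mul_of_nonneg_left (hM₁ y) (Real.exp_pos _).le
        _ = M₁ * Real.exp (-(c / 2 * -y)) := by
            rw [mul_left_comm, ← Real.exp_add]; congr 2; ring
        _ ≤ _ := mul_le_mul_of_nonneg_right (by linarith) (Real.exp_pos _).le
  have hFc : Continuous (𝓕 g) :=
    VectorFourier.fourierIntegral_continuous Real.continuous_fourierChar
      (L := innerₗ ℝ) (by exact continuous_inner) hgi
  have hcont : Continuous fun y : ℝ => Complex.exp (c * y) * f y := by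
    have : (fun y : ℝ => Complex.exp (c * y) * f y)
        = fun y : ℝ => (2 * Real.pi : ℂ)⁻¹ * 𝓕 g (y / (2 * Real.pi)) := by
      funext y
      rw [hfourier]
      field_simp
    rw [this]
    exact continuous_const.mul (hFc.comp (by fun_prop))
  have hreal : Integrable fun y : ℝ => Complex.exp (c * y) * f y := by
    obtain ⟨M, hM⟩ := hbound
    exact ((integrable_exp_neg_mul_abs (κ := c / 2) (by positivity)).const_mul M).mono'
      hcont.aestronglyMeasurable (Eventually.of_forall hM)
  have hsplit : ∀ y : ℝ, Complex.exp (γ * y) * f y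
      = Complex.exp (γ.im * y * Complex.I) * (Complex.exp (c * y) * f y) := by
    intro y
    rw [← mul_assoc, ← Complex.exp_add]
    congr 2
    conv_lhs => rw [← Complex.re_add_im γ]
    rw [hc]
    ring
  refine ⟨?_, ?_⟩
  · refine hreal.mono ?_ (Eventually.of_forall fun y => ?_)
    · simp only [hsplit]
      exact ((by fun_prop : Continuous fun y : ℝ =>
        Complex.exp (γ.im * y * Complex.I)).mul hcont).aestronglyMeasurable
    · rw [hsplit, norm_mul, ← Complex.ofReal_mul, Complex.norm_exp_ofReal_mul_I, one_mul]
  · have hFi : Integrable (𝓕 g) := by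
      have h := (hreal.const_mul (2 * Real.pi : ℂ)).comp_mul_left' (R := 2 * Real.pi)
        (by positivity)
      refine h.congr (Eventually.of_forall fun w => ?_)
      simp only
      rw [← hfourier]
      field_simp
    have hinv := congrFun (hgc.fourierInv_fourier_eq hgi hFi) γ.im
    have hγe : verticalLine c γ.im = γ := Complex.re_add_im γ
    simp only [hg, hγe] at hinv
    rw [← hinv, Real.fourierInv_eq']
    have hsub := Measure.integral_comp_mul_left
      (fun y : ℝ => Complex.exp (γ * y) * f y) (2 * Real.pi)
    rw [abs_of_pos (by positivity), Complex.real_smul] at hsub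
    have h2 : ∫ y : ℝ, Complex.exp (γ * y) * f y = 2 * Real.pi *
        ∫ w : ℝ, Complex.exp (γ * ((2 * Real.pi * w : ℝ) : ℂ)) * f (2 * Real.pi * w) := by
      rw [hsub]
      push_cast
      field_simp
    rw [h2, ← integral_const_mul]
    refine integral_congr_ae (Eventually.of_forall fun w => ?_)
    have h3 := hfourier (2 * Real.pi * w)
    rw [show 2 * Real.pi * w / (2 * Real.pi) = w by field_simp] at h3
    simp only [smul_eq_mul, hsplit]
    simp only [hg] at h3
    rw [h3]
    have e : ((2 * Real.pi * inner ℝ w γ.im : ℝ) : ℂ) * Complex.I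
        = γ.im * ((2 * Real.pi * w : ℝ) : ℂ) * Complex.I := by
      simp
      ring
    rw [e]
    ring

/-! ### The Laplace transforms of the coefficients -/

/-- The integral of `airyKernel` along a vertical line. -/
noncomputable def airyIntegral (c : ℝ) (k : ℕ) (y : ℝ) : ℂ :=
  ∫ τ : ℝ, airyKernel k y (verticalLine c τ)

/-- Multiplication by y is differentiation in s: the integral of the derivative of `airyKernel (k +
1) y` along the line is zero. -/
lemma mul_airyIntegral {c : ℝ} (hc : 0 < c) (k : ℕ) (y : ℝ) :
    y * airyIntegral c (k + 1) y = (k - 5 / 2) * airyIntegral c k y + airyIntegral c (k + 3) y / 4 := by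
  have hi := fun k => integrable_airyKernel k y hc
  have i1 := ((hi k).const_mul ((k : ℂ) - 5 / 2)).fun_add ((hi (k + 3)).div_const 4)
  have h := integral_eq_zero_of_hasDerivAt_of_integrable
    (fun τ => (hasDerivAt_airyKernel_succ k y (s := verticalLine c τ) (by simpa using hc)).comp τ
      (hasDerivAt_verticalLine c τ))
    ((i1.sub' ((hi (k + 1)).const_mul (y : ℂ))).mul_const _) (hi (k + 1))
  rw [integral_mul_const] at h
  have h' := (mul_eq_zero.mp h).resolve_right Complex.I_ne_zero
  rw [integral_sub i1 ((hi (k + 1)).const_mul (y : ℂ)),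
    integral_add ((hi k).const_mul ((k : ℂ) - 5 / 2)) ((hi (k + 3)).div_const 4),
    integral_const_mul, integral_const_mul, integral_div] at h'
  simp only [airyIntegral]
  linear_combination -h'

lemma sq_mul_airyIntegral {c : ℝ} (hc : 0 < c) (k : ℕ) (y : ℝ) :
    y ^ 2 * airyIntegral c (k + 2) y = (k - 3 / 2) * (k - 5 / 2) * airyIntegral c k y
      + (k - 1 / 2) / 2 * airyIntegral c (k + 3) y + airyIntegral c (k + 6) y / 16 := by
  have h1 := mul_airyIntegral hc (k + 1) y
  have h2 := mul_airyIntegral hc k y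
  have h3 := mul_airyIntegral hc (k + 3) y
  push_cast at h1 h2 h3
  simp only [add_assoc] at h1 h2 h3
  norm_num at h1 h2 h3
  linear_combination y * h1 + (k - 3 / 2) * h2 + h3 / 4

lemma airyKernel_eq_mul_exp (k : ℕ) (y : ℝ) (s : ℂ) :
    airyKernel k y s = airyKernel k 0 s * Complex.exp (-(y * s)) := by
  rw [airyKernel, airyKernel, mul_assoc (s ^ k * _), ← Complex.exp_add]
  congr 2
  push_cast
  ring

/-- The bilateral Laplace transforms of the coefficients of the soft edge expansion, in terms of
`airyKernel`. -/
noncomputable def softEdgeLaplace : ℕ → ℂ → ℂ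
  | 0, s => 1 / (2 * √Real.pi) * airyKernel 2 0 s
  | 1, s => -(1 / (160 * √Real.pi)) *
      (60 * airyKernel 1 0 s + 20 * airyKernel 4 0 s + airyKernel 7 0 s)
  | 2, s => 1 / (179200 * √Real.pi) *
      (-42000 * airyKernel 0 0 s + 28000 * airyKernel 3 0 s + 14840 * airyKernel 6 0 s
        + 680 * airyKernel 9 0 s + 7 * airyKernel 12 0 s)
  | _, _ => 0

lemma differentiableOn_softEdgeLaplace {i : ℕ} (hi : i ≤ 2) :
    DifferentiableOn ℂ (softEdgeLaplace i) {s | 0 < s.re} := by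
  have h := fun k => differentiableOn_airyKernel k 0
  interval_cases i
  · exact (h 2).const_mul _
  · exact ((((h 1).const_mul _).add ((h 4).const_mul _)).add (h 7)).const_mul _
  · exact ((((((h 0).const_mul _).add ((h 3).const_mul _)).add ((h 6).const_mul _)).add
      ((h 9).const_mul _)).add ((h 12).const_mul _)).const_mul _

lemma integrable_softEdgeLaplace {i : ℕ} (hi : i ≤ 2) {c : ℝ} (hc : 0 < c) :
    Integrable fun τ : ℝ => softEdgeLaplace i (verticalLine c τ) := by
  have h := fun k => integrable_airyKernel k 0 hc
  interval_cases i
  · exact (h 2).const_mul _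
  · exact ((((h 1).const_mul _).add ((h 4).const_mul _)).add (h 7)).const_mul _
  · exact ((((((h 0).const_mul _).add ((h 3).const_mul _)).add ((h 6).const_mul _)).add
      ((h 9).const_mul _)).add ((h 12).const_mul _)).const_mul _

lemma softEdgeCoeff_eq_integral {i : ℕ} (hi : i ≤ 2) {c : ℝ} (hc : 0 < c) (y : ℝ) :
    softEdgeCoeff c y i = (2 * Real.pi : ℂ)⁻¹ *
      ∫ τ : ℝ, softEdgeLaplace i (verticalLine c τ) * Complex.exp (-(y * verticalLine c τ)) := by
  have h := fun k => integrable_airyKernel k y hc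
  have hpi : (Real.pi : ℂ) ≠ 0 := by exact_mod_cast Real.pi_pos.ne'
  have hsq : (√Real.pi : ℂ) ≠ 0 := by exact_mod_cast (Real.sqrt_pos.mpr Real.pi_pos).ne'
  have e1 := sq_mul_airyIntegral hc 1 y
  have e2 := sq_mul_airyIntegral hc 2 y
  have e0 := sq_mul_airyIntegral hc 0 y
  have e3 := sq_mul_airyIntegral hc 3 y
  have e6 := sq_mul_airyIntegral hc 6 y
  norm_num at e0 e1 e2 e3 e6
  interval_cases i
  · have l : ∀ τ : ℝ, softEdgeLaplace 0 (verticalLine c τ) * Complex.exp (-(y * verticalLine c τ))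
        = 1 / (2 * √Real.pi) * airyKernel 2 y (verticalLine c τ) := fun τ => by
      rw [airyKernel_eq_mul_exp 2 y, softEdgeLaplace]; ring
    simp only [l, softEdgeCoeff, softEdgeTerm_zero y (verticalLine_ne_zero hc _)]
    rw [integral_const_mul]
    field_simp
    ring
  · have l : ∀ τ : ℝ, softEdgeLaplace 1 (verticalLine c τ) * Complex.exp (-(y * verticalLine c τ))
        = -(1 / (160 * √Real.pi)) * (60 * airyKernel 1 y (verticalLine c τ)
          + 20 * airyKernel 4 y (verticalLine c τ) + airyKernel 7 y (verticalLine c τ)) :=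
      fun τ => by
        rw [airyKernel_eq_mul_exp 1 y, airyKernel_eq_mul_exp 4 y, airyKernel_eq_mul_exp 7 y,
          softEdgeLaplace]
        ring
    simp only [l, softEdgeCoeff, softEdgeTerm_one y (verticalLine_ne_zero hc _)]
    rw [integral_sub ((h 7).const_mul _) ((h 3).const_mul _), integral_const_mul,
      integral_const_mul, integral_const_mul,
      integral_add (((h 1).const_mul _).fun_add ((h 4).const_mul _)) (h 7),
      integral_add ((h 1).const_mul _) ((h 4).const_mul _), integral_const_mul,
      integral_const_mul]
    simp only [airyIntegral] at e1
    rw [e1]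
    field_simp
    ring
  · have l : ∀ τ : ℝ, softEdgeLaplace 2 (verticalLine c τ) * Complex.exp (-(y * verticalLine c τ))
        = 1 / (179200 * √Real.pi) * (-42000 * airyKernel 0 y (verticalLine c τ)
          + 28000 * airyKernel 3 y (verticalLine c τ) + 14840 * airyKernel 6 y (verticalLine c τ)
          + 680 * airyKernel 9 y (verticalLine c τ) + 7 * airyKernel 12 y (verticalLine c τ)) :=
      fun τ => by
        rw [airyKernel_eq_mul_exp 0 y, airyKernel_eq_mul_exp 3 y, airyKernel_eq_mul_exp 6 y,
          airyKernel_eq_mul_exp 9 y, airyKernel_eq_mul_exp 12 y, softEdgeLaplace]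
        ring
    simp only [l, softEdgeCoeff, softEdgeTerm_two y (verticalLine_ne_zero hc _)]
    rw [integral_add ((((h 9).const_mul _).fun_add ((h 12).const_mul _)).sub' ((h 8).const_mul _))
        ((h 4).const_mul _),
      integral_sub (((h 9).const_mul _).fun_add ((h 12).const_mul _)) ((h 8).const_mul _),
      integral_add ((h 9).const_mul _) ((h 12).const_mul _), integral_const_mul,
      integral_const_mul, integral_const_mul, integral_const_mul, integral_const_mul,
      integral_add (((((h 0).const_mul _).fun_add ((h 3).const_mul _)).fun_add ((h 6).const_mul _)).fun_add
        ((h 9).const_mul _)) ((h 12).const_mul _),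
      integral_add ((((h 0).const_mul _).fun_add ((h 3).const_mul _)).fun_add ((h 6).const_mul _))
        ((h 9).const_mul _),
      integral_add (((h 0).const_mul _).fun_add ((h 3).const_mul _)) ((h 6).const_mul _),
      integral_add ((h 0).const_mul _) ((h 3).const_mul _), integral_const_mul,
      integral_const_mul, integral_const_mul, integral_const_mul, integral_const_mul]
    -- The factor y⁴ is removed in two rounds. Reducing y² times index 4 (`e2`) produces indices 2,
    -- 5 and 8, still multiplied by y², and `e0`, `e3`, `e6` reduce these. The coefficient of `e6`
    -- is 1/32 - 1/20 = -3/160, since the original y² term at index 8 joins in.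
    have H : 1 / 28 * airyIntegral c 9 y + 1 / 800 * airyIntegral c 12 y
        - y ^ 2 / 20 * airyIntegral c 8 y + y ^ 4 / 2 * airyIntegral c 4 y
        = 1 / 89600 * (-42000 * airyIntegral c 0 y + 28000 * airyIntegral c 3 y
          + 14840 * airyIntegral c 6 y + 680 * airyIntegral c 9 y + 7 * airyIntegral c 12 y) := by
      linear_combination y ^ 2 / 2 * e2 - e0 / 8 + 3 / 8 * e3 - 3 / 160 * e6
    simp only [airyIntegral] at H
    rw [H]
    field_simp
    ring

/-- `softEdgeLaplace i` is the bilateral Laplace transform of the `i`-th coefficient of the soft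
edge expansion. -/
theorem IsGUESoftEdgeExpansion.bilateralLaplace_eq {r : ℕ → ℝ → ℝ}
    (hr : IsGUESoftEdgeExpansion 2 r) {γ : ℂ} (hγ : 0 < γ.re) {i : ℕ} (hi : i ≤ 2) :
    Integrable (fun y : ℝ => Complex.exp (γ * y) * (r i y : ℂ)) ∧
      bilateralLaplace (r i) γ = softEdgeLaplace i γ :=
  integrable_and_integral_exp_mul_eq (f := fun y => (r i y : ℂ))
    (differentiableOn_softEdgeLaplace hi) (fun _ hc => integrable_softEdgeLaplace hi hc)
    (fun _ hc y => (hr.eq_softEdgeCoeff hc y hi).trans (softEdgeCoeff_eq_integral hi hc y)) hγ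

/-! ### Closed forms with principal powers of γ. -/

lemma airyKernel_apply_zero (k : ℕ) (s : ℂ) :
    airyKernel k 0 s = s ^ k * s ^ (-7 / 2 : ℂ) * Complex.exp (s ^ 3 / 12) := by
  simp [airyKernel]

theorem mainTheorem10 :
    (∃ r : ℕ → ℝ → ℝ, IsGUESoftEdgeExpansion 2 r) ∧
    ∀ r : ℕ → ℝ → ℝ, IsGUESoftEdgeExpansion 2 r →
      ∀ γ : ℂ, 0 < γ.re →
        (∀ j ≤ 2, Integrable (fun y : ℝ => Complex.exp (γ * y) * (r j y : ℂ))) ∧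
        bilateralLaplace (r 0) γ =
          Complex.exp (γ ^ 3 / 12) / (2 * (√Real.pi : ℂ) * γ ^ (3 / 2 : ℂ)) ∧
        bilateralLaplace (r 1) γ =
          -(Complex.exp (γ ^ 3 / 12) / (160 * (√Real.pi : ℂ) * γ ^ (5 / 2 : ℂ))) *
            (60 + 20 * γ ^ 3 + γ ^ 6) ∧
        bilateralLaplace (r 2) γ =
          Complex.exp (γ ^ 3 / 12) / (179200 * (√Real.pi : ℂ) * γ ^ (7 / 2 : ℂ)) *
            (-42000 + 28000 * γ ^ 3 + 14840 * γ ^ 6 + 680 * γ ^ 9 + 7 * γ ^ 12) := by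
  refine ⟨exists_isGUESoftEdgeExpansion, fun r hr γ hγ =>
    ⟨fun j hj => (hr.bilateralLaplace_eq hγ hj).1, ?_⟩⟩
  have h0 := ne_zero_of_re_pos hγ
  have hsq : (√Real.pi : ℂ) ≠ 0 := by exact_mod_cast (Real.sqrt_pos.mpr Real.pi_pos).ne'
  have hp : γ ^ (3 / 2 : ℂ) ≠ 0 := by simp [Complex.cpow_eq_zero_iff, h0]
  have h5 : γ ^ (5 / 2 : ℂ) = γ * γ ^ (3 / 2 : ℂ) := by
    rw [show (5 / 2 : ℂ) = 1 + 3 / 2 by norm_num, Complex.cpow_add _ _ h0, Complex.cpow_one]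
  have h7 : γ ^ (7 / 2 : ℂ) = γ ^ 2 * γ ^ (3 / 2 : ℂ) := by
    rw [show (7 / 2 : ℂ) = (2 : ℕ) + 3 / 2 by norm_num, Complex.cpow_add _ _ h0,
      Complex.cpow_natCast]
  have hm7 : γ ^ (-7 / 2 : ℂ) = (γ ^ 2 * γ ^ (3 / 2 : ℂ))⁻¹ := by
    rw [← h7, ← Complex.cpow_neg]
    congr 1
    ring
  rw [(hr.bilateralLaplace_eq hγ (by norm_num : 0 ≤ 2)).2,
    (hr.bilateralLaplace_eq hγ (by norm_num : 1 ≤ 2)).2,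
    (hr.bilateralLaplace_eq hγ (by norm_num : 2 ≤ 2)).2]
  simp only [softEdgeLaplace, airyKernel_apply_zero, hm7, h5, h7]
  refine ⟨?_, ?_, ?_⟩ <;> field_simp
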